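/- Let $A\in\mathbb R^{n\times d}$ with rows $A_1,\dots,A_n$, let $b\in\mathbb R^n$, and suppose that $Ax=b$ is solvable. Let $H$ be the set of solutions, $P_H$ the orthogonal projection onto $H$, and $x^*_{\mathrm{row}}=P_H(0)$. Let $x_0\in\mathbb R^d$ and $\mathrm{rrow}(A)=\mathrm{span}\{A_i: A_i'x_0\ne b_i\}$. Given a rule $\varphi$ that assigns to each $x\in\mathbb R^d$ a probability law on $\mathbb R^n$, generate $w_k,x_k$ $(k\ge 0)$ by drawing $w_k$, given $x_0,\dots,x_k$, from the law $\varphi(x_k)$ and putting $$x_{k+1}=x_k+\frac{A'w_kw_k'(b-Ax_k)}{\|A'w_k\|_2^2}\qquad(x_{k+1}=x_k\text{ if }A'w_k=0).$$ Let $\varphi$ be one of the following; all of them select a standard basis vector $e_i$, and ties are broken by a (possibly random) rule that depends only on the set of maximizers. 1. Maximum residual: $i$ maximizes $|A_i'x-b_i|$. 2. Maximum distance: $i$ maximizes $|A_i'x-b_i|/\|A_i\|_2^p$, with $p=1$ or $p=2$ (and $0/0=0$). 3. Greedy Randomized Kaczmarz: for $Ax\ne b$, let $\varepsilon=\frac12\left(\frac{1}{\|Ax-b\|_2^2}\max_i\frac{|A_i'x-b_i|^2}{\|A_i\|_2^2}+\frac1{\|A\|_F^2}\right)$;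 an index $i$ with $|A_i'x-b_i|^2\ge\varepsilon\|Ax-b\|_2^2\|A_i\|_2^2$ is drawn with probability proportional to $|A_i'x-b_i|^2$. (For $Ax=b$ the law of $i$ is arbitrary.) 4. Sampling Kaczmarz–Motzkin with $1\le\psi\le n$: a subset of $\{1,\dots,n\}$ of size $\psi$ is drawn uniformly at random, and $i$ maximizes $|A_i'x-b_i|$ over this subset. Put $c=1$ for methods 1–3 and $c=n/\psi$ for method 4. Then the following holds. (a) The procedure is 1-Markovian (the law of $w_k$ given $x_0,\dots,x_k$ depends only on $x_k$); magnitude invariant ($\varphi(x)=\varphi(P_H(x)+\lambda(x-P_H(x)))$ in law for all $x\notin H$, $\lambda>0$); and exploratory (for every subspace $V\subsetneq\mathrm{rrow}(A)$ there is $\pi\in(0,1]$ such that, for $w$ drawn from $\varphi(x)$, $\mathbb P[A'w\perp V]\le1-\pi$ for all $x$ with $\|x-x^*_{\mathrm{row}}\|_2=1$, $x-x^*_{\mathrm{row}}\in V$). Moreover $\gamma:=1-\inf_F\det(F'F)\in[0,1)$, where $F$ runs over the matrices whose columns are the normalized members of a maximal linearly independent subset of $\{A'w_1,\dots,A'w_d\}$,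 each $w_j$ being a possible value of $\varphi(x_j)$ for some $x_j\in\mathbb R^d$. (b) Say that the process converges along stopping times with rate $\gamma'$ and constant $\kappa$ if there are stopping times $\tau_1,\tau_2,\dots$ for the filtration $\sigma(w_0,\dots,w_k)$, increasing (strictly as long as they are finite), such that $\mathbb E[\tau_\ell]\le\ell\kappa<\infty$ for all $\ell\ge1$ and, almost surely, either $\tau_\ell<\infty$ and $x_{\tau_\ell+1}\in H$ for some $\ell\ge1$, or, for all $\ell\ge1$, $\tau_\ell<\infty$ and $$\|x_{\tau_\ell+1}-P_H(x_0)\|_2^2\le(\gamma')^\ell\,\|x_0-P_H(x_0)\|_2^2.$$ Then there is a constant $\kappa$, depending only on $A$, $b$, $x_0$ and $\varphi$, such that the process converges along stopping times with the rate $\gamma$ of (a) and the constant $\kappa$. (c) If $x_0\notin H$, there is a $\gamma'\in[0,1)$, depending only on $A$, $b$, $x_0$ and $\varphi$, such that the process converges along stopping times with rate $\gamma'$ and constant $\kappa=c\,\dim\mathrm{rrow}(A)$, that is, $\kappa=\dim\mathrm{rrow}(A)$ for methods 1–3 and $\kappa=n\dim\mathrm{rrow}(A)/\psi$ for Sampling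 Kaczmarz–Motzkin. -/

import Mathlib

open MeasureTheory
open scoped ENNReal NNReal

noncomputable section

namespace AdaptiveKaczmarz

/-- `ℝ^m` with the Euclidean norm. -/
abbrev E (m : ℕ) := EuclideanSpace ℝ (Fin m)

variable {n d : ℕ}

/-! ### The linear system -/

/-- The map `x ↦ A x`. -/
abbrev mulA (A : Matrix (Fin n) (Fin d) ℝ) : E d →ₗ[ℝ] E n := Matrix.toEuclideanLin A

/-- The map `w ↦ A' w`. -/
abbrev mulAT (A : Matrix (Fin n) (Fin d) ℝ) : E n →ₗ[ℝ] E d :=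
  Matrix.toEuclideanLin A.transpose

/-- The `i`-th row of `A`, as a vector of `ℝ^d`. -/
def row (A : Matrix (Fin n) (Fin d) ℝ) (i : Fin n) : E d := WithLp.toLp 2 (A i)

/-- The `i`-th standard basis vector of `ℝ^n`. -/
def basisVec (i : Fin n) : E n := EuclideanSpace.single i 1

/-- The residual `A x - b`. -/
def residual (A : Matrix (Fin n) (Fin d) ℝ) (b : E n) (x : E d) : E n := mulA A x - b

/-- The flat `H` of all solutions of `A x = b`. -/
def solutionSet (A : Matrix (Fin n) (Fin d) ℝ) (b : E n) : AffineSubspace ℝ (E d) where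
  carrier := {x | mulA A x = b}
  smul_vsub_vadd_mem' := by
    intro c p q r hp hq hr
    simp only [Set.mem_ofPred_eq] at *
    simp [map_add, map_sub, hp, hq, hr]

open Classical in
/-- The orthogonal projection `P_H` onto the flat of solutions
(the junk value `x` is taken only if the system is inconsistent). -/
def projSol (A : Matrix (Fin n) (Fin d) ℝ) (b : E n) (x : E d) : E d :=
  if h : Nonempty (solutionSet A b) then
    haveI := h
    (EuclideanGeometry.orthogonalProjection (solutionSet A b) x : E d)
  else x

/-- The unique solution in the row space of `A`: the solution of least norm. -/
def rowSol (A : Matrix (Fin n) (Fin d) ℝ) (b : E n) : E d := projSol A b 0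

/-- The restricted row space: the span of the rows whose equation is violated at `x₀`. -/
def rrow (A : Matrix (Fin n) (Fin d) ℝ) (b : E n) (x₀ : E d) : Submodule ℝ (E d) :=
  Submodule.span ℝ {v | ∃ i, v = row A i ∧ inner ℝ (row A i) x₀ ≠ b i}

/-! ### Adaptive procedures -/

/-- An adaptive procedure (for a fixed system): the law of `w_k` given the iterates
`x_0, …, x_k`. -/
abbrev Procedure (n d : ℕ) := (k : ℕ) → (Fin (k + 1) → E d) → PMF (E n)

/-- The law of `w_k` depends only on the iterates `x_j` with `k - η < j ≤ k`. -/
def IsMarkovian (η : ℕ) (Φ : Procedure n d) : Prop :=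
  ∀ (k : ℕ) (h h' : Fin (k + 1) → E d),
    (∀ j : Fin (k + 1), k < (j : ℕ) + η → h j = h' j) → Φ k h = Φ k h'

/-- The procedure that draws `w_k` from `φ x_k`. -/
def ofStep (φ : E d → PMF (E n)) : Procedure n d := fun k h => φ (h (Fin.last k))

/-- Magnitude invariance. -/
def MagnitudeInvariant (A : Matrix (Fin n) (Fin d) ℝ) (b : E n) (φ : E d → PMF (E n)) : Prop :=
  ∀ x : E d, mulA A x ≠ b → ∀ lam : ℝ, 0 < lam →
    φ x = φ (projSol A b x + lam • (x - projSol A b x))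

/-- The exploratory property: for each proper subspace `V` of the restricted row space, the
probability that `A' w ⊥ V` is at most `1 - π` for some `π ∈ (0, 1]`, uniformly in the points `x`
of the unit sphere around the row space solution whose error lies in `V`. -/
def Exploratory (A : Matrix (Fin n) (Fin d) ℝ) (b : E n) (x₀ : E d)
    (φ : E d → PMF (E n)) : Prop :=
  ∀ V : Submodule ℝ (E d), V < rrow A b x₀ →
    ∃ p : ℝ, 0 < p ∧ p ≤ 1 ∧ ∀ x : E d, ‖x - rowSol A b‖ = 1 → x - rowSol A b ∈ V →
      (φ x).toOuterMeasure {w | mulAT A w ∈ Vᗮ} ≤ ENNReal.ofReal (1 - p)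

/-- The numbers `det (F' F)`, where the columns of `F` are the normalized members of a maximal
linearly independent subfamily (indexed by `S`) of `A' w_1, …, A' w_d`, and where each `w_j` is a
possible value of the procedure at some point `x_j` of `ℝ^d`. -/
def gramDets (A : Matrix (Fin n) (Fin d) ℝ) (φ : E d → PMF (E n)) : Set ℝ :=
  {r | ∃ (x : Fin d → E d) (w : Fin d → E n) (S : Finset (Fin d)),
    (∀ j, w j ∈ (φ (x j)).support) ∧
    LinearIndependent ℝ (fun j : S => mulAT A (w j)) ∧
    (∀ j, mulAT A (w j) ∈ Submodule.span ℝ (Set.range fun j : S => mulAT A (w j))) ∧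
    ∃ F : Matrix (Fin d) S ℝ,
      F = Matrix.of (fun a (j : S) => (‖mulAT A (w j)‖⁻¹ • mulAT A (w j)) a) ∧
      r = (F.transpose * F).det}

/-- The rate `γ = 1 - inf det (F' F)`. -/
def rate (A : Matrix (Fin n) (Fin d) ℝ) (φ : E d → PMF (E n)) : ℝ := 1 - sInf (gramDets A φ)

/-- On the probability space `(Ω, μ)`, the processes `x` and `w` are generated by the procedure
`Φ` from `x₀`: given `x_0, …, x_k`, the vector `w_k` has law `Φ k (x_0, …, x_k)`, and
`x_{k+1} = x_k + A' w_k w_k' (b - A x_k) / ‖A' w_k‖²` (no move is made if `A' w_k = 0`).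
The iterates take countably many values almost surely, so that conditional laws given the past
are the elementary ones. -/
structure Generates {Ω : Type*} [MeasurableSpace Ω] (μ : Measure Ω)
    (A : Matrix (Fin n) (Fin d) ℝ) (b : E n) (x₀ : E d) (Φ : Procedure n d)
    (x : ℕ → Ω → E d) (w : ℕ → Ω → E n) : Prop where
  measurable : ∀ k, Measurable (w k)
  init : ∀ ω, x 0 ω = x₀
  update : ∀ k ω, x (k + 1) ω = x k ω +
    (inner ℝ (w k ω) (b - mulA A (x k ω)) / ‖mulAT A (w k ω)‖ ^ 2) • mulAT A (w k ω)
  law : ∀ (k : ℕ) (h : Fin (k + 1) → E d) (v : E n),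
    μ {ω | (∀ j : Fin (k + 1), x j ω = h j) ∧ w k ω = v} =
      μ {ω | ∀ j : Fin (k + 1), x j ω = h j} * Φ k h v

/-- Convergence with rate `γ` along stopping times whose means grow at most like `κ ℓ`. There is an
increasing sequence of stopping times `τ_1, τ_2, …` (`τ l` is `τ_{l+1}`) for the filtration
`σ(w_0, …, w_k)` such that almost surely either the iterates terminate at a solution, in the sense
that `x_{τ_ℓ + 1}` is a solution for some finite `τ_ℓ`, or all `τ_ℓ` are finite and
`‖x_{τ_ℓ + 1} - P_H x_0‖² ≤ γ ^ ℓ ‖x_0 - P_H x_0‖²` for all `ℓ`; moreover `𝔼 τ_ℓ ≤ ℓ κ`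
for all `ℓ` (so that every `τ_ℓ` is almost surely finite, with finite mean). -/
def ConvergesAlong {Ω : Type*} [MeasurableSpace Ω] (μ : Measure Ω)
    (A : Matrix (Fin n) (Fin d) ℝ) (b : E n) (x₀ : E d)
    (x : ℕ → Ω → E d) (w : ℕ → Ω → E n) (hw : ∀ k, Measurable (w k))
    (γ : ℝ) (κ : ℝ≥0) : Prop :=
  ∃ τ : ℕ → Ω → ℕ∞,
    (∀ l, IsStoppingTime (Filtration.natural w fun k => (hw k).stronglyMeasurable) (τ l)) ∧
    (∀ l ω, τ l ω ≤ τ (l + 1) ω ∧ (τ l ω ≠ ⊤ → τ l ω < τ (l + 1) ω)) ∧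
    (∀ᵐ ω ∂μ,
      (∃ l, ∃ m : ℕ, τ l ω = m ∧ mulA A (x (m + 1) ω) = b) ∨
      (∀ l, ∃ m : ℕ, τ l ω = m ∧
        ‖x (m + 1) ω - projSol A b x₀‖ ^ 2 ≤ γ ^ (l + 1) * ‖x₀ - projSol A b x₀‖ ^ 2)) ∧
    (∀ l, ∫⁻ ω, (τ l ω : ℝ≥0∞) ∂μ ≤ ((l + 1 : ℕ) : ℝ≥0∞) * (κ : ℝ≥0∞))

/-! ### The four methods -/

/-- A rule for breaking ties, possibly at random: it picks an element of each nonempty set of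
indices, with a law that depends only on this set. -/
structure TieBreak (n : ℕ) where
  /-- the law of the index picked from a set -/
  law : Finset (Fin n) → PMF (Fin n)
  mem_of_mem_support : ∀ S : Finset (Fin n), S.Nonempty → ∀ i ∈ (law S).support, i ∈ S

open Classical in
/-- The maximizers of `f` over the finite set `S`. -/
def argmax (S : Finset (Fin n)) (f : Fin n → ℝ) : Finset (Fin n) :=
  S.filter (fun i => ∀ j ∈ S, f j ≤ f i)

/-- The maximum residual method: a maximizer of `|e' (A x - b)|` over the standard basis. -/
def maxResidual (A : Matrix (Fin n) (Fin d) ℝ) (b : E n) (t : TieBreak n) (x : E d) :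
    PMF (E n) :=
  (t.law (argmax Finset.univ fun i => |residual A b x i|)).map basisVec

/-- The maximum distance method: a maximizer of `|e' (A x - b)| / ‖A' e‖ ^ p` over the standard
basis. The exponent `p = 1` gives the distances to the hyperplanes; `p = 2` is used as well. -/
def maxDistance (A : Matrix (Fin n) (Fin d) ℝ) (b : E n) (p : ℕ) (t : TieBreak n) (x : E d) :
    PMF (E n) :=
  (t.law (argmax Finset.univ fun i => |residual A b x i| / ‖row A i‖ ^ p)).map basisVec

/-- The threshold of the Greedy Randomized Kaczmarz method. -/
def grkThreshold (A : Matrix (Fin n) (Fin d) ℝ) (b : E n) (x : E d) : ℝ :=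
  (1 / 2) * (1 / ‖residual A b x‖ ^ 2 * (⨆ i, |residual A b x i| ^ 2 / ‖row A i‖ ^ 2) +
    1 / ∑ i, ‖row A i‖ ^ 2)

open Classical in
/-- The weights of the Greedy Randomized Kaczmarz method: the squared residual for the equations
with `|A_i x - b_i|² ≥ threshold * ‖A x - b‖² * ‖A_i‖²`, zero for the others. -/
def grkWeight (A : Matrix (Fin n) (Fin d) ℝ) (b : E n) (x : E d) (i : Fin n) : ℝ≥0∞ :=
  if grkThreshold A b x * ‖residual A b x‖ ^ 2 * ‖row A i‖ ^ 2 ≤ |residual A b x i| ^ 2 then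
    ENNReal.ofReal (|residual A b x i| ^ 2)
  else 0

theorem grkWeight_tsum_ne_top (A : Matrix (Fin n) (Fin d) ℝ) (b : E n) (x : E d) :
    ∑' i, grkWeight A b x i ≠ ⊤ := by
  rw [tsum_fintype]
  refine ENNReal.sum_ne_top.2 fun i _ => ?_
  unfold grkWeight
  split_ifs
  · exact ENNReal.ofReal_ne_top
  · exact ENNReal.zero_ne_top

open Classical in
/-- The Greedy Randomized Kaczmarz method: `e_i` is drawn with probability proportional to
`grkWeight`. At a solution all weights vanish and the method has terminated; there an arbitrary
law `q` of the index is used, which does not affect the iterates. -/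
def greedyRandomized (A : Matrix (Fin n) (Fin d) ℝ) (b : E n) (q : PMF (Fin n)) (x : E d) :
    PMF (E n) :=
  (if h : ∑' i, grkWeight A b x i ≠ 0 then
    PMF.normalize (grkWeight A b x) h (grkWeight_tsum_ne_top A b x)
  else q).map basisVec

/-- The weights of the Greedy Randomized Kaczmarz method vanish only at a solution. -/
theorem grkWeight_tsum_ne_zero (A : Matrix (Fin n) (Fin d) ℝ) (b : E n)
    (hsol : ∃ xs, mulA A xs = b) (x : E d) (hx : mulA A x ≠ b) :
    ∑' i, grkWeight A b x i ≠ 0 := by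
  rw [tsum_fintype]
  obtain ⟨xs, hxs⟩ := hsol
  obtain ⟨r, hr⟩ : ∃ r, r = residual A b x := ⟨_, rfl⟩
  have hr0 : r ≠ 0 := fun h => hx (sub_eq_zero.1 (hr.symm.trans h))
  have hzero : ∀ i, row A i = 0 → r i = 0 := by
    intro i hi
    have hAi : A i = 0 := by
      have := congrArg WithLp.ofLp hi
      simpa [row] using this
    have hy : ∀ y : E d, mulA A y i = 0 := fun y => by
      simp [mulA, Matrix.mulVec, hAi]
    simp only [hr, residual, ← hxs, PiLp.sub_apply, hy, sub_zero]
  have hne : Nonempty (Fin n) := by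
    by_contra h
    rw [not_nonempty_iff] at h
    exact hr0 (Subsingleton.elim _ _)
  obtain ⟨i₀, hi₀⟩ := Finite.exists_max fun i => |r i| ^ 2 / ‖row A i‖ ^ 2
  have hsup : (⨆ i, |r i| ^ 2 / ‖row A i‖ ^ 2) = |r i₀| ^ 2 / ‖row A i₀‖ ^ 2 :=
    le_antisymm (ciSup_le hi₀) (le_ciSup (f := fun i => |r i| ^ 2 / ‖row A i‖ ^ 2)
      (Set.finite_range _).bddAbove i₀)
  obtain ⟨M, hM⟩ : ∃ M, M = |r i₀| ^ 2 / ‖row A i₀‖ ^ 2 := ⟨_, rfl⟩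
  rw [← hM] at hsup hi₀
  have hle : ∀ i, |r i| ^ 2 ≤ M * ‖row A i‖ ^ 2 := by
    intro i
    by_cases h : row A i = 0
    · simp [h, hzero i h]
    · exact (div_le_iff₀ (pow_pos (norm_pos_iff.2 h) 2)).1 (hi₀ i)
  have hnorm : ‖r‖ ^ 2 ≤ M * ∑ i, ‖row A i‖ ^ 2 := by
    rw [EuclideanSpace.norm_sq_eq, Finset.mul_sum]
    exact Finset.sum_le_sum fun i _ => by simpa using hle i
  have hrpos : 0 < ‖r‖ ^ 2 := pow_pos (norm_pos_iff.2 hr0) 2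
  have hFnn : 0 ≤ ∑ i, ‖row A i‖ ^ 2 := Finset.sum_nonneg fun i _ => sq_nonneg _
  have hMnn : 0 ≤ M := hM ▸ div_nonneg (sq_nonneg _) (sq_nonneg _)
  have hF : 0 < ∑ i, ‖row A i‖ ^ 2 := by
    rcases hFnn.lt_or_eq with h | h
    · exact h
    · rw [← h] at hnorm
      linarith
  have hMpos : 0 < M := by
    rcases hMnn.lt_or_eq with h | h
    · exact h
    · rw [← h] at hnorm
      linarith
  have hrow : row A i₀ ≠ 0 := by
    intro h
    rw [hM, h] at hMpos
    simp at hMpos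
  have hMeq : M * ‖row A i₀‖ ^ 2 = |r i₀| ^ 2 := by
    rw [hM]
    have : ‖row A i₀‖ ≠ 0 := norm_ne_zero_iff.2 hrow
    field_simp
  have hri : 0 < |r i₀| ^ 2 := by
    rw [← hMeq]
    exact mul_pos hMpos (pow_pos (norm_pos_iff.2 hrow) 2)
  have hthr : grkThreshold A b x * ‖r‖ ^ 2 ≤ M := by
    have h1 : grkThreshold A b x * ‖r‖ ^ 2 =
        (1 / 2) * (M + ‖r‖ ^ 2 / ∑ i, ‖row A i‖ ^ 2) := by
      unfold grkThreshold
      rw [← hr, hsup]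
      have : ‖r‖ ≠ 0 := norm_ne_zero_iff.2 hr0
      field_simp
    have h2 : ‖r‖ ^ 2 / ∑ i, ‖row A i‖ ^ 2 ≤ M := (div_le_iff₀ hF).2 hnorm
    linarith
  have hw : grkWeight A b x i₀ ≠ 0 := by
    unfold grkWeight
    rw [if_pos]
    · rw [← hr]
      exact (ENNReal.ofReal_pos.2 hri).ne'
    · rw [← hr, ← hMeq]
      exact mul_le_mul_of_nonneg_right hthr (sq_nonneg _)
  intro h
  exact hw (Finset.sum_eq_zero_iff.1 h i₀ (Finset.mem_univ _))

/-- The Sampling Kaczmarz-Motzkin method: a subset of `ψ` equations is drawn uniformly, then an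
equation of this subset with maximal residual is selected. -/
def samplingMotzkin (A : Matrix (Fin n) (Fin d) ℝ) (b : E n) (ψ : ℕ) (hψ : ψ ≤ n)
    (t : TieBreak n) (x : E d) : PMF (E n) :=
  (PMF.uniformOfFinset (Finset.powersetCard ψ (Finset.univ : Finset (Fin n)))
    (Finset.powersetCard_nonempty.2 (by simpa using hψ))).bind fun S =>
      (t.law (argmax S fun i => |residual A b x i|)).map basisVec

/-- `IsMethod A b φ c`: the step law `φ` is one of the four methods for the system `A x = b`, and
`c` is the factor belonging to it: `n / ψ` for Sampling Kaczmarz-Motzkin with samples of size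
`ψ`, and `1` for the others. -/
inductive IsMethod (A : Matrix (Fin n) (Fin d) ℝ) (b : E n) :
    (E d → PMF (E n)) → ℝ≥0 → Prop
  | maxResidual (t : TieBreak n) : IsMethod A b (maxResidual A b t) 1
  | maxDistance (p : ℕ) (hp : p = 1 ∨ p = 2) (t : TieBreak n) :
      IsMethod A b (maxDistance A b p t) 1
  | greedyRandomized (q : PMF (Fin n)) : IsMethod A b (greedyRandomized A b q) 1
  | samplingMotzkin (ψ : ℕ) (hψ₁ : 1 ≤ ψ) (hψ : ψ ≤ n) (t : TieBreak n) :
      IsMethod A b (samplingMotzkin A b ψ hψ t) ((n : ℝ≥0) / (ψ : ℝ≥0))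

end AdaptiveKaczmarz

end

namespace AdaptiveKaczmarz

variable {n d : ℕ}

/-! Fix z = P_H(x₀). Each update projects the error x - z orthogonally off the direction A'w, so the
error stays in (ker A)^⊥ and its norm never grows. What the four methods share is domination: with
conditional probability at least 1/c the selected row satisfies r_j² ‖A_i‖² ≤ C r_i² for all j,
where r = Ax - b and C does not depend on x (`IsMethod.exists_dominant`). Summing over j and using
that A is bounded below on (ker A)^⊥, such a step contracts the squared error by a fixed factor g <
1 (`exists_contraction_of_dominant`). Hence a contraction occurs at each step with conditional
probability at least 1/c, and the mean waiting time for m of them is at most c m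
(`lintegral_tsum_count_le`).

Convergence follows by stopping at every M-th contraction (`Generates.convergesAlong`). With M = 1
the rate is g and the constant is c, which is at most c dim rrow(A) because this dimension is
positive off H. To reach the rate γ > 0 of the Gram determinants, choose M with g^M ≤ γ. If γ = 0,
any two possible directions are orthogonal or parallel, so as long as the error is nonzero each
contraction uses up a new dimension, and d + 1 contractions end exactly at z
(`count_le_finrank_span`).

Domination also yields exploration: a dominant row orthogonal to the error has zero residual, which
forces x to be a solution. Magnitude invariance holds because the residual is multiplied by λ when
the error is. Finally γ < 1 because there are only finitely many Gram determinants, all positive. -/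

/-! ### Linear algebra of the system and its residual -/

theorem mulA_apply_eq_inner (A : Matrix (Fin n) (Fin d) ℝ) (x : E d) (i : Fin n) :
    mulA A x i = inner ℝ (row A i) x := by
  simp [row, Matrix.mulVec, dotProduct, PiLp.inner_apply, mul_comm]

theorem mulAT_basisVec (A : Matrix (Fin n) (Fin d) ℝ) (i : Fin n) :
    mulAT A (basisVec i) = row A i := by
  ext j
  simp [row, basisVec]

theorem mulAT_eq_adjoint (A : Matrix (Fin n) (Fin d) ℝ) :
    mulAT A = LinearMap.adjoint (mulA A) := by
  rw [← Matrix.toEuclideanLin_conjTranspose_eq_adjoint, Matrix.conjTranspose_eq_transpose_of_trivial]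

theorem inner_mulAT (A : Matrix (Fin n) (Fin d) ℝ) (w : E n) (x : E d) :
    inner ℝ (mulAT A w) x = inner ℝ w (mulA A x) := by
  rw [mulAT_eq_adjoint, LinearMap.adjoint_inner_left]

theorem mulAT_mem_orthogonal_ker (A : Matrix (Fin n) (Fin d) ℝ) (w : E n) :
    mulAT A w ∈ (mulA A).kerᗮ := by
  rw [LinearMap.orthogonal_ker, mulAT_eq_adjoint]
  exact ⟨w, rfl⟩

theorem residual_of_solution {A : Matrix (Fin n) (Fin d) ℝ} {b : E n} {z : E d}
    (hz : mulA A z = b) (x : E d) : residual A b x = mulA A (x - z) := by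
  rw [residual, map_sub, hz]

theorem residual_apply_eq_inner {A : Matrix (Fin n) (Fin d) ℝ} {b : E n} {z : E d}
    (hz : mulA A z = b) (x : E d) (i : Fin n) :
    residual A b x i = inner ℝ (row A i) (x - z) := by
  rw [residual_of_solution hz, mulA_apply_eq_inner]

theorem residual_eq_zero_iff {A : Matrix (Fin n) (Fin d) ℝ} {b : E n} {x : E d} :
    residual A b x = 0 ↔ mulA A x = b := sub_eq_zero

theorem mulA_eq_of_residual_apply {A : Matrix (Fin n) (Fin d) ℝ} {b : E n} {x : E d}
    (h : ∀ i, residual A b x i = 0) : mulA A x = b :=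
  residual_eq_zero_iff.1 (by ext i; exact h i)

theorem residual_apply_of_row_eq_zero {A : Matrix (Fin n) (Fin d) ℝ} {b : E n}
    (hsol : ∃ xs, mulA A xs = b) (x : E d) {i : Fin n} (hi : row A i = 0) :
    residual A b x i = 0 := by
  obtain ⟨z, hz⟩ := hsol
  rw [residual_apply_eq_inner hz, hi, inner_zero_left]

theorem mulA_projSol {A : Matrix (Fin n) (Fin d) ℝ} {b : E n}
    (hsol : ∃ xs, mulA A xs = b) (x : E d) : mulA A (projSol A b x) = b := by
  obtain ⟨z, hz⟩ := hsol
  have h : Nonempty (solutionSet A b) := ⟨⟨z, hz⟩⟩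
  rw [projSol, dif_pos h]
  exact (EuclideanGeometry.orthogonalProjection (solutionSet A b) x).2

theorem sub_projSol_mem {A : Matrix (Fin n) (Fin d) ℝ} {b : E n}
    (hsol : ∃ xs, mulA A xs = b) (x : E d) : x - projSol A b x ∈ (mulA A).kerᗮ := by
  obtain ⟨z, hz⟩ := hsol
  have h : Nonempty (solutionSet A b) := ⟨⟨z, hz⟩⟩
  rw [projSol, dif_pos h]
  refine Submodule.orthogonal_le ?_
    (EuclideanGeometry.vsub_orthogonalProjection_mem_direction_orthogonal (solutionSet A b) x)
  intro v hv
  have hzv : z + v ∈ solutionSet A b := by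
    change mulA A (z + v) = b
    rw [map_add, hz, LinearMap.mem_ker.1 hv, add_zero]
  simpa using AffineSubspace.vsub_mem_direction hzv (show z ∈ solutionSet A b from hz)

theorem eq_zero_of_mem_orthogonal_ker {A : Matrix (Fin n) (Fin d) ℝ} {y : E d}
    (hy : y ∈ (mulA A).kerᗮ) (h : mulA A y = 0) : y = 0 :=
  inner_self_eq_zero.1 (hy y h)

theorem rrow_le_orthogonal_ker (A : Matrix (Fin n) (Fin d) ℝ) (b : E n) (x₀ : E d) :
    rrow A b x₀ ≤ (mulA A).kerᗮ := by
  refine Submodule.span_le.2 ?_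
  rintro _ ⟨i, rfl, -⟩
  rw [← mulAT_basisVec]
  exact mulAT_mem_orthogonal_ker A _

theorem row_norm_sq_le (A : Matrix (Fin n) (Fin d) ℝ) (i : Fin n) :
    ‖row A i‖ ^ 2 ≤ ∑ j, ‖row A j‖ ^ 2 :=
  Finset.single_le_sum (f := fun j => ‖row A j‖ ^ 2) (fun _ _ => sq_nonneg _) (Finset.mem_univ i)

/-! ### Dominant indices and the selection rules -/

/-- The index `i` dominates at `x`: its squared distance is comparable to the squared norm of the
residual, and its equation is violated unless `x` is a solution. -/
def Dominant (A : Matrix (Fin n) (Fin d) ℝ) (b : E n) (C : ℝ) (x : E d) (i : Fin n) : Prop :=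
  (∀ j, residual A b x j ^ 2 * ‖row A i‖ ^ 2 ≤ C * residual A b x i ^ 2) ∧
    (residual A b x i = 0 → mulA A x = b)

theorem argmax_nonempty {S : Finset (Fin n)} (hS : S.Nonempty) (f : Fin n → ℝ) :
    (argmax S f).Nonempty := by
  obtain ⟨i, hi, h⟩ := S.exists_max_image f hS
  exact ⟨i, Finset.mem_filter.2 ⟨hi, h⟩⟩

theorem TieBreak.isMax_of_mem_support (t : TieBreak n) {S : Finset (Fin n)} (hS : S.Nonempty)
    {f : Fin n → ℝ} {i : Fin n} (hi : i ∈ (t.law (argmax S f)).support) :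
    i ∈ S ∧ ∀ j ∈ S, f j ≤ f i := by
  classical
  have := t.mem_of_mem_support _ (argmax_nonempty hS f) i hi
  simpa [argmax] using this

theorem dominant_of_max {A : Matrix (Fin n) (Fin d) ℝ} {b : E n} {x : E d} {i : Fin n}
    (h : ∀ j, |residual A b x j| ≤ |residual A b x i|) :
    Dominant A b (∑ j, ‖row A j‖ ^ 2) x i := by
  refine ⟨fun j => ?_, fun h0 => mulA_eq_of_residual_apply fun j => ?_⟩
  · rw [mul_comm]
    exact mul_le_mul (row_norm_sq_le A i) (sq_le_sq.2 (h j)) (sq_nonneg _)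
      (Finset.sum_nonneg fun _ _ => sq_nonneg _)
  · have := h j
    rw [h0, abs_zero] at this
    exact abs_nonpos_iff.1 this

/-- Rows equal to zero, where the quotient takes the default value 0, have zero residual by
consistency, so they cannot hide a violated equation. -/
theorem violated_of_max_div {A : Matrix (Fin n) (Fin d) ℝ} {b : E n}
    (hsol : ∃ xs, mulA A xs = b) {x : E d} {i : Fin n} {p : ℕ}
    (h : ∀ j, |residual A b x j| / ‖row A j‖ ^ p ≤ |residual A b x i| / ‖row A i‖ ^ p)
    (h0 : residual A b x i = 0) : mulA A x = b := by
  refine mulA_eq_of_residual_apply fun j => ?_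
  by_cases hj : row A j = 0
  · exact residual_apply_of_row_eq_zero hsol x hj
  · have := h j
    rw [h0, abs_zero, zero_div] at this
    have hpos : 0 < ‖row A j‖ ^ p := pow_pos (norm_pos_iff.2 hj) p
    rw [div_le_iff₀ hpos, zero_mul] at this
    exact abs_nonpos_iff.1 this

theorem cross_le_of_max_div {A : Matrix (Fin n) (Fin d) ℝ} {b : E n}
    (hsol : ∃ xs, mulA A xs = b) {x : E d} {i : Fin n} {p : ℕ} (hi : row A i ≠ 0)
    (h : ∀ j, |residual A b x j| / ‖row A j‖ ^ p ≤ |residual A b x i| / ‖row A i‖ ^ p)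
    (j : Fin n) :
    |residual A b x j| * ‖row A i‖ ^ p ≤ |residual A b x i| * ‖row A j‖ ^ p := by
  have hpi : 0 < ‖row A i‖ ^ p := pow_pos (norm_pos_iff.2 hi) p
  by_cases hj : row A j = 0
  · rw [residual_apply_of_row_eq_zero hsol x hj, abs_zero, zero_mul]
    positivity
  · exact (div_le_div_iff₀ (pow_pos (norm_pos_iff.2 hj) p) hpi).1 (h j)

theorem dominant_of_max_dist {A : Matrix (Fin n) (Fin d) ℝ} {b : E n}
    (hsol : ∃ xs, mulA A xs = b) {x : E d} {i : Fin n}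
    (h : ∀ j, |residual A b x j| / ‖row A j‖ ^ 1 ≤ |residual A b x i| / ‖row A i‖ ^ 1) :
    Dominant A b (∑ j, ‖row A j‖ ^ 2) x i := by
  refine ⟨fun j => ?_, violated_of_max_div hsol h⟩
  by_cases hi : row A i = 0
  · rw [hi, norm_zero]
    have : 0 ≤ ∑ j, ‖row A j‖ ^ 2 := Finset.sum_nonneg fun _ _ => sq_nonneg _
    nlinarith [mul_nonneg this (sq_nonneg (residual A b x i))]
  -- Cross-multiplied maximality gives r_j² ‖A_i‖² ≤ r_i² ‖A_j‖², and ‖A_j‖² is at most the squared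
  -- Frobenius norm.
  · have hc := pow_le_pow_left₀ (by positivity) (cross_le_of_max_div hsol hi h j) 2
    rw [pow_one, pow_one, mul_pow, mul_pow, sq_abs, sq_abs] at hc
    nlinarith [mul_le_mul_of_nonneg_left (row_norm_sq_le A j) (sq_nonneg (residual A b x i))]

/-- For p = 2 the comparison reads r_j² ‖A_i‖⁴ ≤ r_i² ‖A_j‖⁴; a surplus factor ‖A_i‖² must be
divided out, which costs the lower bound `ρ` on the nonzero rows. -/
theorem dominant_of_max_dist_sq {A : Matrix (Fin n) (Fin d) ℝ} {b : E n}
    (hsol : ∃ xs, mulA A xs = b) {x : E d} {i : Fin n} {ρ : ℝ} (hρ : 0 < ρ)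
    (hrow : ∀ i, row A i ≠ 0 → ρ ≤ ‖row A i‖ ^ 2)
    (h : ∀ j, |residual A b x j| / ‖row A j‖ ^ 2 ≤ |residual A b x i| / ‖row A i‖ ^ 2) :
    Dominant A b ((∑ j, ‖row A j‖ ^ 2) ^ 2 / ρ) x i := by
  refine ⟨fun j => ?_, violated_of_max_div hsol h⟩
  by_cases hi : row A i = 0
  · rw [hi, norm_zero]
    have : 0 ≤ (∑ j, ‖row A j‖ ^ 2) ^ 2 / ρ := by positivity
    nlinarith [mul_nonneg this (sq_nonneg (residual A b x i))]
  · have hc := pow_le_pow_left₀ (by positivity) (cross_le_of_max_div hsol hi h j) 2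
    rw [mul_pow, mul_pow, sq_abs, sq_abs] at hc
    have h1 : (‖row A j‖ ^ 2) ^ 2 ≤ (∑ j, ‖row A j‖ ^ 2) ^ 2 :=
      pow_le_pow_left₀ (sq_nonneg _) (row_norm_sq_le A j) 2
    have h2 := mul_le_mul_of_nonneg_left h1 (sq_nonneg (residual A b x i))
    have h3 : ρ * ‖row A i‖ ^ 2 ≤ (‖row A i‖ ^ 2) ^ 2 := by
      rw [sq (‖row A i‖ ^ 2)]
      exact mul_le_mul_of_nonneg_right (hrow i hi) (sq_nonneg _)
    have h4 := mul_le_mul_of_nonneg_left h3 (sq_nonneg (residual A b x j))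
    rw [div_mul_eq_mul_div, le_div_iff₀ hρ]
    linarith

/-- The threshold ε is at least 1 / (2 ‖A‖_F²), so an admissible index has r_i² ≥ ‖r‖² ‖A_i‖² / (2
‖A‖_F²), and ‖r‖² ≥ r_j². A nonzero weight also excludes r_i = 0. -/
theorem dominant_of_grkWeight_ne_zero {A : Matrix (Fin n) (Fin d) ℝ} {b : E n}
    {x : E d} {i : Fin n} (h : grkWeight A b x i ≠ 0) :
    Dominant A b (2 * ∑ j, ‖row A j‖ ^ 2) x i := by
  unfold grkWeight at h
  split_ifs at h with hle
  · have hri : residual A b x i ≠ 0 := by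
      intro h0
      simp [h0] at h
    refine ⟨fun j => ?_, fun h0 => absurd h0 hri⟩
    obtain ⟨R, hR⟩ : ∃ R, R = ∑ j, ‖row A j‖ ^ 2 := ⟨_, rfl⟩
    have hR0 : 0 ≤ R := hR ▸ Finset.sum_nonneg fun _ _ => sq_nonneg _
    have hiR : ‖row A i‖ ^ 2 ≤ R := hR ▸ row_norm_sq_le A i
    have hj : residual A b x j ^ 2 ≤ ‖residual A b x‖ ^ 2 := by
      have := pow_le_pow_left₀ (norm_nonneg _) (PiLp.norm_apply_le (residual A b x) j) 2
      simpa using this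
    have hε : (1 / 2) * (1 / R) ≤ grkThreshold A b x := by
      unfold grkThreshold
      rw [← hR]
      have : 0 ≤ 1 / ‖residual A b x‖ ^ 2 *
          ⨆ i, |residual A b x i| ^ 2 / ‖row A i‖ ^ 2 :=
        mul_nonneg (by positivity) (Real.iSup_nonneg fun i => by positivity)
      linarith
    rw [← hR]
    rcases hR0.lt_or_eq with hpos | h0
    · have h1 : (1 / 2) * (1 / R) * (residual A b x j ^ 2 * ‖row A i‖ ^ 2) ≤
          residual A b x i ^ 2 := by
        rw [← sq_abs (residual A b x i)]
        refine le_trans ?_ hle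
        rw [mul_assoc (grkThreshold A b x)]
        have h3 : residual A b x j ^ 2 * ‖row A i‖ ^ 2 ≤
          ‖residual A b x‖ ^ 2 * ‖row A i‖ ^ 2 := mul_le_mul_of_nonneg_right hj (sq_nonneg _)
        exact mul_le_mul hε h3 (by positivity) (le_trans (by positivity) hε)
      have h2 := mul_le_mul_of_nonneg_left h1 (by positivity : 0 ≤ 2 * R)
      calc _ = 2 * R * (1 / 2 * (1 / R) * (residual A b x j ^ 2 * ‖row A i‖ ^ 2)) := by
            field_simp
        _ ≤ _ := h2
    -- With zero Frobenius norm every row vanishes and both sides are 0.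
    · have : ‖row A i‖ ^ 2 = 0 := le_antisymm (h0 ▸ hiR) (sq_nonneg _)
      rw [this, ← h0]
      simp
  · exact absurd rfl h

theorem dominant_of_solution {A : Matrix (Fin n) (Fin d) ℝ} {b : E n} {C : ℝ} {x : E d}
    (hx : mulA A x = b) (i : Fin n) : Dominant A b C x i := by
  have : residual A b x = 0 := residual_eq_zero_iff.2 hx
  exact ⟨fun j => by simp [this], fun _ => hx⟩

theorem exists_row_norm_sq_lower_bound (A : Matrix (Fin n) (Fin d) ℝ) :
    ∃ ρ : ℝ, 0 < ρ ∧ ∀ i, row A i ≠ 0 → ρ ≤ ‖row A i‖ ^ 2 := by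
  classical
  rcases (Finset.univ.filter fun i => row A i ≠ 0).eq_empty_or_nonempty with h | h
  · refine ⟨1, one_pos, fun i hi => ?_⟩
    have : i ∈ Finset.univ.filter fun i => row A i ≠ 0 := by simp [hi]
    simp [h] at this
  · obtain ⟨i, hi, hmin⟩ := Finset.exists_min_image _ (fun i => ‖row A i‖ ^ 2) h
    exact ⟨‖row A i‖ ^ 2, pow_pos (norm_pos_iff.2 (Finset.mem_filter.1 hi).2) 2,
      fun j hj => hmin j (by simp [hj])⟩

theorem toOuterMeasure_map_basisVec_eq_one {p : PMF (Fin n)} {P : Fin n → Prop}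
    (h : ∀ i ∈ p.support, P i) :
    (p.map basisVec).toOuterMeasure (basisVec '' {i | P i}) = 1 := by
  rw [PMF.toOuterMeasure_apply_eq_one_iff, PMF.support_map]
  exact Set.image_mono h

/-- This is the probability ψ/n that a uniform sample contains `i`, cleared of denominators. The
samples avoiding `i` are those of the remaining n - 1 indices; Pascal's rule leaves C(n-1, ψ-1), and
the absorption identity finishes. -/
theorem card_powersetCard_filter_mem {ψ : ℕ} (hψ : 1 ≤ ψ) (i : Fin n) :
    n * ((Finset.powersetCard ψ (Finset.univ : Finset (Fin n))).filter (i ∈ ·)).card =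
      ψ * n.choose ψ := by
  obtain ⟨k, rfl⟩ := Nat.exists_eq_add_of_le' hψ
  obtain ⟨m, rfl⟩ := Nat.exists_eq_add_of_le' (show 1 ≤ n from i.pos)
  have h1 := Finset.card_filter_add_card_filter_not
    (s := Finset.powersetCard (k + 1) (Finset.univ : Finset (Fin (m + 1)))) (i ∈ ·)
  have h2 : (Finset.powersetCard (k + 1) (Finset.univ : Finset (Fin (m + 1)))).filter (i ∉ ·) =
      Finset.powersetCard (k + 1) (Finset.univ.erase i) := by
    ext S
    simp only [Finset.mem_filter, Finset.mem_powersetCard, Finset.subset_erase]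
    tauto
  rw [h2, Finset.card_powersetCard, Finset.card_powersetCard, Finset.card_erase_of_mem
    (Finset.mem_univ _), Finset.card_fin, Nat.add_sub_cancel, Nat.choose_succ_succ] at h1
  have h3 : ((Finset.powersetCard (k + 1) (Finset.univ : Finset (Fin (m + 1)))).filter
      (i ∈ ·)).card = m.choose k := by simpa using h1
  rw [h3, Nat.add_one_mul_choose_eq, mul_comm]

/-- Fix a global maximizer `i₀` of the residual. It lies in the sample with probability ψ/n, and
then every maximizer over the sample is a global maximizer, hence dominant. -/
theorem samplingMotzkin_dominant {A : Matrix (Fin n) (Fin d) ℝ} {b : E n} {ψ : ℕ} (hψ₁ : 1 ≤ ψ)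
    (hψ : ψ ≤ n) (t : TieBreak n) (x : E d) :
    1 ≤ (((n : ℝ≥0) / (ψ : ℝ≥0) : ℝ≥0) : ℝ≥0∞) * (samplingMotzkin A b ψ hψ t x).toOuterMeasure
      (basisVec '' {i | Dominant A b (∑ j, ‖row A j‖ ^ 2) x i}) := by
  have hn : 0 < n := lt_of_lt_of_le hψ₁ hψ
  have : Nonempty (Fin n) := ⟨⟨0, hn⟩⟩
  obtain ⟨i₀, hi₀⟩ := Finite.exists_max fun i => |residual A b x i|
  rw [samplingMotzkin, PMF.toOuterMeasure_bind_apply]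
  have hne : (Finset.powersetCard ψ (Finset.univ : Finset (Fin n))).Nonempty :=
    Finset.powersetCard_nonempty.2 (by simpa using hψ)
  have hle : (PMF.uniformOfFinset _ hne).toOuterMeasure {S | i₀ ∈ S} ≤
      ∑' S, PMF.uniformOfFinset _ hne S *
        ((t.law (argmax S fun i => |residual A b x i|)).map basisVec).toOuterMeasure
          (basisVec '' {i | Dominant A b (∑ j, ‖row A j‖ ^ 2) x i}) := by
    rw [PMF.toOuterMeasure_apply]
    refine ENNReal.tsum_le_tsum fun S => ?_
    by_cases hS : i₀ ∈ S
    · rw [toOuterMeasure_map_basisVec_eq_one, mul_one]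
      · exact Set.indicator_le_self _ _ _
      · intro i hi
        have := (t.isMax_of_mem_support ⟨i₀, hS⟩ hi).2 i₀ hS
        exact dominant_of_max fun j => (hi₀ j).trans this
    · simp [hS]
  refine le_trans ?_ (mul_le_mul_right hle _)
  rw [PMF.toOuterMeasure_uniformOfFinset_apply]
  have hcard := card_powersetCard_filter_mem (n := n) hψ₁ i₀
  simp only [Set.mem_ofPred_eq]
  obtain ⟨N, hN⟩ : ∃ N, N = ((Finset.powersetCard ψ (Finset.univ : Finset (Fin n))).filter
    (i₀ ∈ ·)).card := ⟨_, rfl⟩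
  rw [← hN] at hcard ⊢
  rw [Finset.card_powersetCard, Finset.card_fin]
  have hch : 0 < n.choose ψ := Nat.choose_pos hψ
  have hψ0 : (ψ : ℝ≥0) ≠ 0 := by exact_mod_cast (by omega : ψ ≠ 0)
  have hch0 : (n.choose ψ : ℝ≥0) ≠ 0 := by exact_mod_cast hch.ne'
  have key : ((n : ℝ≥0) / ψ) * (N / n.choose ψ) = 1 := by
    have : (n : ℝ≥0) * N = ψ * n.choose ψ := by exact_mod_cast hcard
    rw [div_mul_div_comm, this, div_self (mul_ne_zero hψ0 hch0)]
  have : (N : ℝ≥0∞) / (n.choose ψ : ℝ≥0∞) = ((N / n.choose ψ : ℝ≥0) : ℝ≥0∞) := by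
    rw [ENNReal.coe_div hch0]
    simp
  rw [this, ← ENNReal.coe_mul, key, ENNReal.coe_one]

theorem IsMethod.exists_dominant {A : Matrix (Fin n) (Fin d) ℝ} {b : E n}
    (hsol : ∃ xs, mulA A xs = b) {φ : E d → PMF (E n)} {c : ℝ≥0} (hφ : IsMethod A b φ c) :
    ∃ C : ℝ, 0 ≤ C ∧ ∀ x, 1 ≤ (c : ℝ≥0∞) *
      (φ x).toOuterMeasure (basisVec '' {i | Dominant A b C x i}) := by
  have hR : 0 ≤ ∑ j, ‖row A j‖ ^ 2 := Finset.sum_nonneg fun _ _ => sq_nonneg _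
  cases hφ with
  | maxResidual t =>
    refine ⟨_, hR, fun x => ?_⟩
    rw [AdaptiveKaczmarz.maxResidual, toOuterMeasure_map_basisVec_eq_one]
    · simp
    · intro i hi
      have := (t.isMax_of_mem_support ⟨i, Finset.mem_univ _⟩ hi).2
      exact dominant_of_max fun j => this j (Finset.mem_univ _)
  | maxDistance p hp t =>
    obtain ⟨ρ, hρ, hrow⟩ := exists_row_norm_sq_lower_bound A
    rcases hp with rfl | rfl
    · refine ⟨_, hR, fun x => ?_⟩
      rw [AdaptiveKaczmarz.maxDistance, toOuterMeasure_map_basisVec_eq_one]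
      · simp
      · intro i hi
        have := (t.isMax_of_mem_support ⟨i, Finset.mem_univ _⟩ hi).2
        exact dominant_of_max_dist hsol fun j => this j (Finset.mem_univ _)
    · refine ⟨(∑ j, ‖row A j‖ ^ 2) ^ 2 / ρ, by positivity, fun x => ?_⟩
      rw [AdaptiveKaczmarz.maxDistance, toOuterMeasure_map_basisVec_eq_one]
      · simp
      · intro i hi
        have := (t.isMax_of_mem_support ⟨i, Finset.mem_univ _⟩ hi).2
        exact dominant_of_max_dist_sq hsol hρ hrow fun j => this j (Finset.mem_univ _)
  | greedyRandomized q =>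
    refine ⟨2 * ∑ j, ‖row A j‖ ^ 2, by positivity, fun x => ?_⟩
    rw [AdaptiveKaczmarz.greedyRandomized, toOuterMeasure_map_basisVec_eq_one]
    · simp
    · intro i hi
      by_cases hx : mulA A x = b
      -- At a solution the index comes from the arbitrary law `q`, but there every index is
      -- dominant.
      · exact dominant_of_solution hx i
      · rw [dif_pos (grkWeight_tsum_ne_zero A b hsol x hx), PMF.mem_support_normalize_iff] at hi
        exact dominant_of_grkWeight_ne_zero hi
  | samplingMotzkin ψ hψ₁ hψ t =>
    exact ⟨_, hR, samplingMotzkin_dominant hψ₁ hψ t⟩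

theorem IsMethod.support_subset {A : Matrix (Fin n) (Fin d) ℝ} {b : E n}
    {φ : E d → PMF (E n)} {c : ℝ≥0} (hφ : IsMethod A b φ c) (x : E d) :
    (φ x).support ⊆ Set.range basisVec := by
  cases hφ with
  | maxResidual t => exact (PMF.support_map _ _).trans_subset (Set.image_subset_range _ _)
  | maxDistance p hp t => exact (PMF.support_map _ _).trans_subset (Set.image_subset_range _ _)
  | greedyRandomized q => exact (PMF.support_map _ _).trans_subset (Set.image_subset_range _ _)
  | samplingMotzkin ψ hψ₁ hψ t =>
    rw [AdaptiveKaczmarz.samplingMotzkin, PMF.support_bind]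
    exact Set.iUnion₂_subset fun S _ =>
      (PMF.support_map _ _).trans_subset (Set.image_subset_range _ _)

/-! ### Markov property, magnitude invariance and exploration -/

theorem isMarkovian_ofStep (φ : E d → PMF (E n)) : IsMarkovian 1 (ofStep φ) := by
  intro k h h' hh
  rw [ofStep, ofStep, hh (Fin.last k) (by simp)]

theorem residual_scale {A : Matrix (Fin n) (Fin d) ℝ} {b : E n}
    (hsol : ∃ xs, mulA A xs = b) (x : E d) (lam : ℝ) :
    residual A b (projSol A b x + lam • (x - projSol A b x)) = lam • residual A b x := by
  have hz := mulA_projSol hsol x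
  rw [residual_of_solution hz, residual_of_solution hz x, add_sub_cancel_left, map_smul]

theorem argmax_const_mul (S : Finset (Fin n)) (f : Fin n → ℝ) {a : ℝ} (ha : 0 < a) :
    argmax S (fun i => a * f i) = argmax S f := by
  simp [argmax, mul_le_mul_iff_right₀ ha]

/-- The threshold is homogeneous of degree 0 in the residual: the factor a² of the maximum cancels
that of ‖r‖². -/
theorem grkThreshold_of_residual_smul {A : Matrix (Fin n) (Fin d) ℝ} {b : E n} {x y : E d}
    {a : ℝ} (ha : 0 < a) (h : residual A b y = a • residual A b x) :
    grkThreshold A b y = grkThreshold A b x := by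
  have h1 : ∀ i, |residual A b y i| ^ 2 / ‖row A i‖ ^ 2 =
      a ^ 2 * (|residual A b x i| ^ 2 / ‖row A i‖ ^ 2) := fun i => by
    rw [h, PiLp.smul_apply, smul_eq_mul, abs_mul, mul_pow, sq_abs a, mul_div_assoc]
  unfold grkThreshold
  simp_rw [h1]
  rw [← Real.mul_iSup_of_nonneg (sq_nonneg a), h, norm_smul, Real.norm_eq_abs, mul_pow, sq_abs]
  congr 2
  rw [← mul_assoc]
  congr 1
  field_simp

theorem grkWeight_of_residual_smul {A : Matrix (Fin n) (Fin d) ℝ} {b : E n} {x y : E d}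
    {a : ℝ} (ha : 0 < a) (h : residual A b y = a • residual A b x) (i : Fin n) :
    grkWeight A b y i = ENNReal.ofReal (a ^ 2) * grkWeight A b x i := by
  have ha2 : 0 < a ^ 2 := pow_pos ha 2
  unfold grkWeight
  rw [grkThreshold_of_residual_smul ha h, h, PiLp.smul_apply, smul_eq_mul, abs_mul, mul_pow,
    sq_abs a, norm_smul, Real.norm_eq_abs, mul_pow, sq_abs, mul_ite, mul_zero,
    ENNReal.ofReal_mul ha2.le]
  refine if_congr ?_ rfl rfl
  rw [show grkThreshold A b x * (a ^ 2 * ‖residual A b x‖ ^ 2) * ‖row A i‖ ^ 2 =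
    a ^ 2 * (grkThreshold A b x * ‖residual A b x‖ ^ 2 * ‖row A i‖ ^ 2) by ring,
    mul_le_mul_iff_right₀ ha2]

theorem IsMethod.magnitudeInvariant {A : Matrix (Fin n) (Fin d) ℝ} {b : E n}
    (hsol : ∃ xs, mulA A xs = b) {φ : E d → PMF (E n)} {c : ℝ≥0} (hφ : IsMethod A b φ c) :
    MagnitudeInvariant A b φ := by
  intro x hx lam hlam
  have hr := residual_scale hsol x lam
  obtain ⟨y, hy⟩ : ∃ y, y = projSol A b x + lam • (x - projSol A b x) := ⟨_, rfl⟩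
  rw [← hy] at hr ⊢
  have habs : ∀ i, |residual A b y i| = lam * |residual A b x i| := fun i => by
    rw [hr, PiLp.smul_apply, smul_eq_mul, abs_mul, abs_of_pos hlam]
  cases hφ with
  | maxResidual t =>
    simp only [AdaptiveKaczmarz.maxResidual, habs]
    rw [argmax_const_mul _ _ hlam]
  | maxDistance p hp t =>
    simp only [AdaptiveKaczmarz.maxDistance, habs, mul_div_assoc]
    rw [argmax_const_mul _ _ hlam]
  | greedyRandomized q =>
    have hw := grkWeight_of_residual_smul hlam hr
    -- Off the solution set both weight vectors are nonzero, so both laws are normalizations and the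
    -- common factor λ² cancels.
    have hx0 := grkWeight_tsum_ne_zero A b hsol x hx
    have ha0 : ENNReal.ofReal (lam ^ 2) ≠ 0 := (ENNReal.ofReal_pos.2 (pow_pos hlam 2)).ne'
    have hs : ∑' i, grkWeight A b y i = ENNReal.ofReal (lam ^ 2) * ∑' i, grkWeight A b x i := by
      simp_rw [hw, ENNReal.tsum_mul_left]
    have hy0 : ∑' i, grkWeight A b y i ≠ 0 := hs ▸ mul_ne_zero ha0 hx0
    rw [AdaptiveKaczmarz.greedyRandomized, AdaptiveKaczmarz.greedyRandomized, dif_pos hx0,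
      dif_pos hy0]
    congr 1
    ext i
    rw [PMF.normalize_apply, PMF.normalize_apply, hs, hw,
      ENNReal.mul_inv (Or.inl ha0) (Or.inl ENNReal.ofReal_ne_top), mul_mul_mul_comm,
      ENNReal.mul_inv_cancel ha0 ENNReal.ofReal_ne_top, one_mul]
  | samplingMotzkin ψ hψ₁ hψ t =>
    simp only [AdaptiveKaczmarz.samplingMotzkin, habs]
    simp_rw [argmax_const_mul _ _ hlam]

theorem toOuterMeasure_le_of_disjoint {α : Type*} {p : PMF α} {s t : Set α} (h : Disjoint s t)
    {q : ℝ} (hq : 0 ≤ q) (ht : ENNReal.ofReal q ≤ p.toOuterMeasure t) :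
    p.toOuterMeasure s ≤ ENNReal.ofReal (1 - q) := by
  have h1 : p.toOuterMeasure s + p.toOuterMeasure t ≤ 1 := by
    rw [PMF.toOuterMeasure_apply, PMF.toOuterMeasure_apply, ← ENNReal.tsum_add, ← p.tsum_coe]
    refine ENNReal.tsum_le_tsum fun a => ?_
    by_cases hs : a ∈ s
    · simp [hs, Set.disjoint_left.1 h hs]
    · simpa [hs] using Set.indicator_le_self t p a
  rw [ENNReal.ofReal_sub _ hq, ENNReal.ofReal_one]
  exact ENNReal.le_sub_of_add_le_right ENNReal.ofReal_ne_top
    ((add_le_add_right ht _).trans h1)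

theorem IsMethod.one_le_factor {A : Matrix (Fin n) (Fin d) ℝ} {b : E n}
    {φ : E d → PMF (E n)} {c : ℝ≥0} (hφ : IsMethod A b φ c) : 1 ≤ c := by
  cases hφ with
  | samplingMotzkin ψ hψ₁ hψ t =>
    rw [one_le_div (by exact_mod_cast hψ₁)]
    exact_mod_cast hψ
  | _ => exact le_rfl

theorem IsMethod.exploratory {A : Matrix (Fin n) (Fin d) ℝ} {b : E n}
    (hsol : ∃ xs, mulA A xs = b) {φ : E d → PMF (E n)} {c : ℝ≥0} (hφ : IsMethod A b φ c)
    (x₀ : E d) : Exploratory A b x₀ φ := by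
  obtain ⟨C, -, hC⟩ := hφ.exists_dominant hsol
  have hc := hφ.one_le_factor
  have hc0 : 0 < c := lt_of_lt_of_le one_pos hc
  intro V hV
  -- The exploration constant is 1/c, the probability of a dominant index: a dominant row cannot be
  -- orthogonal to `V`, since it would be orthogonal to the error and make `x` a solution, hence
  -- equal to the row space solution.
  refine ⟨(c : ℝ)⁻¹, by positivity, inv_le_one_of_one_le₀ (by exact_mod_cast hc), ?_⟩
  intro x hx1 hxV
  have hz : mulA A (rowSol A b) = b := mulA_projSol hsol 0
  refine toOuterMeasure_le_of_disjoint (t := basisVec '' {i | Dominant A b C x i}) ?_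
    (by positivity) ?_
  · rw [Set.disjoint_left]
    rintro _ hperp ⟨i, hi, rfl⟩
    have hperp : mulAT A (basisVec i) ∈ Vᗮ := hperp
    rw [mulAT_basisVec] at hperp
    have h0 : residual A b x i = 0 := by
      rw [residual_apply_eq_inner hz, real_inner_comm]
      exact hperp _ hxV
    have hAx := hi.2 h0
    have : x - rowSol A b = 0 := eq_zero_of_mem_orthogonal_ker
      (rrow_le_orthogonal_ker A b x₀ (hV.le hxV)) (by rw [map_sub, hAx, hz, sub_self])
    rw [this, norm_zero] at hx1
    exact zero_ne_one hx1
  · have h1 := hC x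
    rw [ENNReal.ofReal_inv_of_pos (by exact_mod_cast hc0), ENNReal.ofReal_coe_nnreal,
      ENNReal.inv_le_iff_le_mul (fun _ => by exact_mod_cast hc0.ne') (by simp)]
    exact h1

/-! ### One step of the iteration -/

/-- One update of the iterate `x` in the direction `w`. -/
noncomputable def stepFn (A : Matrix (Fin n) (Fin d) ℝ) (b : E n) (x : E d) (w : E n) : E d :=
  x + (inner ℝ w (b - mulA A x) / ‖mulAT A w‖ ^ 2) • mulAT A w

theorem stepFn_sub {A : Matrix (Fin n) (Fin d) ℝ} {b : E n} {z : E d} (hz : mulA A z = b)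
    (x : E d) (w : E n) :
    stepFn A b x w - z =
      (x - z) - (inner ℝ (mulAT A w) (x - z) / ‖mulAT A w‖ ^ 2) • mulAT A w := by
  have : inner ℝ w (b - mulA A x) = - inner ℝ (mulAT A w) (x - z) := by
    rw [inner_mulAT, map_sub, hz, ← inner_neg_right, neg_sub]
  rw [stepFn, this, neg_div, neg_smul]
  abel

/-- Pythagoras; for v = 0 the division by zero gives 0 and the identity persists. -/
theorem norm_sq_sub_proj {F : Type*} [NormedAddCommGroup F] [InnerProductSpace ℝ F] (v y : F) :
    ‖y - (inner ℝ v y / ‖v‖ ^ 2) • v‖ ^ 2 = ‖y‖ ^ 2 - inner ℝ v y ^ 2 / ‖v‖ ^ 2 := by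
  by_cases hv : v = 0
  · simp [hv]
  · have hv' : ‖v‖ ≠ 0 := norm_ne_zero_iff.2 hv
    rw [norm_sub_sq_real, inner_smul_right, norm_smul, mul_pow, Real.norm_eq_abs, sq_abs,
      real_inner_comm v y]
    field_simp
    ring

theorem norm_sq_stepFn_sub {A : Matrix (Fin n) (Fin d) ℝ} {b : E n} {z : E d}
    (hz : mulA A z = b) (x : E d) (w : E n) :
    ‖stepFn A b x w - z‖ ^ 2 =
      ‖x - z‖ ^ 2 - inner ℝ (mulAT A w) (x - z) ^ 2 / ‖mulAT A w‖ ^ 2 := by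
  rw [stepFn_sub hz, norm_sq_sub_proj]

theorem norm_sq_stepFn_sub_le {A : Matrix (Fin n) (Fin d) ℝ} {b : E n} {z : E d}
    (hz : mulA A z = b) (x : E d) (w : E n) :
    ‖stepFn A b x w - z‖ ^ 2 ≤ ‖x - z‖ ^ 2 := by
  rw [norm_sq_stepFn_sub hz]
  have : 0 ≤ inner ℝ (mulAT A w) (x - z) ^ 2 / ‖mulAT A w‖ ^ 2 := by positivity
  linarith

theorem stepFn_sub_mem {A : Matrix (Fin n) (Fin d) ℝ} {b : E n} {z : E d} (hz : mulA A z = b)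
    {x : E d} (hx : x - z ∈ (mulA A).kerᗮ) (w : E n) :
    stepFn A b x w - z ∈ (mulA A).kerᗮ := by
  rw [stepFn_sub hz]
  exact Submodule.sub_mem _ hx (Submodule.smul_mem _ _ (mulAT_mem_orthogonal_ker A w))

/-- `A` is injective on (ker A)^⊥, and an injective linear map in finite dimension is bounded below.
-/
theorem exists_norm_sq_le_mulA (A : Matrix (Fin n) (Fin d) ℝ) :
    ∃ K : ℝ, 0 ≤ K ∧ ∀ y ∈ (mulA A).kerᗮ, ‖y‖ ^ 2 ≤ K * ‖mulA A y‖ ^ 2 := by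
  obtain ⟨K, -, hK⟩ := ((mulA A).domRestrict (mulA A).kerᗮ).exists_antilipschitzWith (by
    rw [LinearMap.ker_eq_bot']
    intro y hy
    exact Subtype.ext (eq_zero_of_mem_orthogonal_ker y.2 hy))
  refine ⟨(K : ℝ) ^ 2, sq_nonneg _, fun y hy => ?_⟩
  have h := hK.le_mul_dist ⟨y, hy⟩ 0
  rw [dist_eq_norm, dist_eq_norm, sub_zero, map_zero, sub_zero] at h
  rw [← mul_pow]
  exact pow_le_pow_left₀ (norm_nonneg _) h 2

/-- Steps along dominant indices contract the error uniformly. -/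
theorem exists_contraction_of_dominant (A : Matrix (Fin n) (Fin d) ℝ) (b : E n) {C : ℝ}
    (hC : 0 ≤ C) : ∃ g : ℝ, 0 ≤ g ∧ g < 1 ∧ ∀ z, mulA A z = b → ∀ x, x - z ∈ (mulA A).kerᗮ →
      ∀ i, Dominant A b C x i → ‖stepFn A b x (basisVec i) - z‖ ^ 2 ≤ g * ‖x - z‖ ^ 2 := by
  obtain ⟨K, hK0, hK⟩ := exists_norm_sq_le_mulA A
  have hD0 : 0 ≤ K * (n * C) := by positivity
  -- The squared error drops by r_i² / ‖A_i‖², and K n C r_i² ≥ ‖x - z‖² ‖A_i‖². The summand 1 keeps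
  -- the denominator positive when K n C = 0.
  refine ⟨1 - 1 / (1 + K * (n * C)), ?_, ?_, ?_⟩
  · rw [sub_nonneg, div_le_one (by linarith)]
    linarith
  · have : 0 < 1 / (1 + K * (n * C)) := by positivity
    linarith
  intro z hz x hx i hi
  rw [norm_sq_stepFn_sub hz, mulAT_basisVec, ← residual_apply_eq_inner hz]
  by_cases hrow : row A i = 0
  -- For a zero row the first clause of `Dominant` is void; the second one shows that the error is
  -- already 0.
  · have hAx := hi.2 (residual_apply_of_row_eq_zero ⟨z, hz⟩ x hrow)
    have : x - z = 0 := eq_zero_of_mem_orthogonal_ker hx (by rw [map_sub, hAx, hz, sub_self])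
    simp [this, hrow]
  · have hpos : 0 < ‖row A i‖ ^ 2 := pow_pos (norm_pos_iff.2 hrow) 2
    have h1 : ‖mulA A (x - z)‖ ^ 2 * ‖row A i‖ ^ 2 ≤ n * C * residual A b x i ^ 2 := by
      rw [← residual_of_solution hz, EuclideanSpace.norm_sq_eq, Finset.sum_mul]
      refine (Finset.sum_le_card_nsmul _ _ (C * residual A b x i ^ 2) fun j _ => ?_).trans ?_
      · rw [Real.norm_eq_abs, sq_abs]
        exact hi.1 j
      · rw [Finset.card_fin, nsmul_eq_mul, mul_assoc]
    have h2 := mul_le_mul_of_nonneg_right (hK _ hx) hpos.le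
    have h3 : ‖x - z‖ ^ 2 * ‖row A i‖ ^ 2 ≤ (1 + K * (n * C)) * residual A b x i ^ 2 := by
      nlinarith [mul_le_mul_of_nonneg_left h1 hK0, sq_nonneg (residual A b x i)]
    have h4 : 1 / (1 + K * (n * C)) * ‖x - z‖ ^ 2 ≤ residual A b x i ^ 2 / ‖row A i‖ ^ 2 := by
      rw [le_div_iff₀ hpos, div_mul_eq_mul_div, one_mul, div_mul_eq_mul_div, div_le_iff₀ (by linarith)]
      linarith
    linarith

/-! ### The time of the `l`-th occurrence -/

open Classical in
/-- The time at which `p` holds for the `(l + 1)`-st time. -/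
noncomputable def nthTime (p : ℕ → Prop) (l : ℕ) : ℕ∞ :=
  if h : ∃ k, l < Nat.count p (k + 1) then (Nat.find h : ℕ∞) else ⊤

open Classical in
theorem nthTime_le_iff (p : ℕ → Prop) (l i : ℕ) :
    nthTime p l ≤ i ↔ l < Nat.count p (i + 1) := by
  unfold nthTime
  split_ifs with h
  · rw [Nat.cast_le, Nat.find_le_iff]
    constructor
    · rintro ⟨m, hm, hl⟩
      exact hl.trans_le (Nat.count_monotone p (by omega))
    · exact fun hl => ⟨i, le_rfl, hl⟩
  · push Not at h
    simpa using h i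

theorem nthTime_lt_nthTime {p : ℕ → Prop} {l l' : ℕ} (hl : l < l') (h : nthTime p l ≠ ⊤) :
    nthTime p l < nthTime p l' := by
  classical
  by_contra hle
  rw [not_lt] at hle
  obtain ⟨m, hm⟩ := ENat.ne_top_iff_exists.1 h
  have h1 := (nthTime_le_iff p l' m).1 (hle.trans hm.symm.le)
  -- The count grows by at most one per step, so reaching `l'` > `l` by time `m` would put
  -- occurrence `l` before `m`.
  have h2 : l < Nat.count p m := by
    rw [Nat.count_succ] at h1
    split_ifs at h1 <;> omega
  cases m with
  | zero => simp at h2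
  | succ m =>
    have := (nthTime_le_iff p l m).2 h2
    rw [← hm] at this
    exact absurd (Nat.cast_le.1 this) (by omega)

theorem nthTime_le_nthTime {p : ℕ → Prop} {l l' : ℕ} (hl : l < l') :
    nthTime p l ≤ nthTime p l' := by
  by_cases h : nthTime p l = ⊤
  · classical
    rw [h, top_le_iff]
    by_contra h'
    obtain ⟨m, hm⟩ := ENat.ne_top_iff_exists.1 h'
    have h1 := (nthTime_le_iff p l' m).1 hm.symm.le
    have h2 := (nthTime_le_iff p l m).2 (hl.trans h1)
    rw [h, top_le_iff] at h2
    exact ENat.natCast_ne_top m h2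
  · exact (nthTime_lt_nthTime hl h).le

open Classical in
-- At each k up to the time of occurrence `l`, at most `l` occurrences precede k. The sum turns the
-- mean of a waiting time into a sum of probabilities.
theorem coe_nthTime_le_tsum (p : ℕ → Prop) (l : ℕ) :
    (nthTime p l : ℝ≥0∞) ≤ ∑' k, if Nat.count p k ≤ l then 1 else 0 := by
  have key : ∀ N : ℕ, (N : ℕ∞) ≤ nthTime p l →
      (N : ℝ≥0∞) ≤ ∑' k, if Nat.count p k ≤ l then 1 else 0 := by
    intro N hN
    refine le_trans ?_ (ENNReal.sum_le_tsum (Finset.range N))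
    rw [Finset.sum_congr rfl (g := fun _ => 1)]
    · simp
    · intro k hk
      rw [if_pos]
      cases k with
      | zero => simp
      | succ k =>
        by_contra hc
        have h1 := hN.trans ((nthTime_le_iff p l k).2 (not_le.1 hc))
        have := Nat.cast_le.1 h1
        have := Finset.mem_range.1 hk
        omega
  by_cases h : nthTime p l = ⊤
  · rw [h]
    refine le_of_eq (Eq.symm ?_)
    rw [ENat.toENNReal_top]
    exact ENNReal.eq_top_of_forall_nnreal_le fun r => by
      obtain ⟨N, hN⟩ := exists_nat_ge r
      exact le_trans (by exact_mod_cast hN) (key N (by rw [h]; exact le_top))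
  · obtain ⟨m, hm⟩ := ENat.ne_top_iff_exists.1 h
    rw [← hm]
    simpa using key m hm.le

open Classical in
-- The sum counts only the first l + 1 occurrences. The induction carries the bound by the total
-- count as well: a new term appears only when that count is at most `l`.
theorem tsum_occurrence_le (p : ℕ → Prop) (l : ℕ) :
    (∑' k, if Nat.count p k ≤ l ∧ p k then (1 : ℝ≥0∞) else 0) ≤ ((l + 1 : ℕ) : ℝ≥0∞) := by
  have key : ∀ N, (∑ k ∈ Finset.range N, if Nat.count p k ≤ l ∧ p k then 1 else 0) ≤ l + 1 ∧
      (∑ k ∈ Finset.range N, if Nat.count p k ≤ l ∧ p k then 1 else 0) ≤ Nat.count p N := by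
    intro N
    induction N with
    | zero => simp
    | succ N ih =>
      rw [Finset.sum_range_succ, Nat.count_succ]
      by_cases hp : p N <;> by_cases hc : Nat.count p N ≤ l <;> simp only [hp, hc, and_self,
        and_true, and_false, if_true, if_false] <;> omega
  rw [ENNReal.tsum_eq_iSup_nat]
  refine iSup_le fun N => ?_
  have := (key N).1
  calc _ = (((∑ k ∈ Finset.range N, if Nat.count p k ≤ l ∧ p k then 1 else 0) : ℕ) : ℝ≥0∞) := by
        push_cast
        rfl
    _ ≤ _ := by exact_mod_cast this

open Classical in
theorem measurableSet_lt_count {Ω : Type*} [m : MeasurableSpace Ω] {p : Ω → ℕ → Prop} {k : ℕ}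
    (h : ∀ j < k, MeasurableSet {ω | p ω j}) (l : ℕ) :
    MeasurableSet {ω | l < Nat.count (p ω) k} := by
  have hm : Measurable fun ω => Nat.count (p ω) k := by
    have : (fun ω => Nat.count (p ω) k) =
        fun ω => ∑ j ∈ Finset.range k, Set.indicator {ω | p ω j} (fun _ => 1) ω := by
      funext ω
      rw [Nat.count_eq_card_filter_range, Finset.card_filter]
      exact Finset.sum_congr rfl fun j _ => by simp [Set.indicator_apply]
    rw [this]
    exact Finset.measurable_fun_sum _ fun j hj =>
      measurable_const.indicator (h j (Finset.mem_range.1 hj))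
  exact measurableSet_lt measurable_const hm

open Classical in
/-- If, given that `p` has occurred at most `l` times before `k`, it occurs at `k` with
probability at least `1 / c`, then the mean waiting time for `l + 1` occurrences is at most
`c (l + 1)`. -/
theorem lintegral_tsum_count_le {Ω : Type*} [MeasurableSpace Ω] {μ : Measure Ω}
    {p : Ω → ℕ → Prop} (hp : ∀ j, MeasurableSet {ω | p ω j}) {c : ℝ≥0∞}
    (h : ∀ k l, μ {ω | Nat.count (p ω) k ≤ l} ≤ c * μ {ω | Nat.count (p ω) k ≤ l ∧ p ω k})
    (l : ℕ) :
    ∫⁻ ω, ∑' k, (if Nat.count (p ω) k ≤ l then 1 else 0) ∂μ ≤ c * ((l + 1 : ℕ) : ℝ≥0∞) * μ Set.univ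
    := by
  have hm : ∀ k, MeasurableSet {ω | Nat.count (p ω) k ≤ l} := fun k => by
    simpa [Set.compl_ofPred] using (measurableSet_lt_count (k := k) (fun j _ => hp j) l).compl
  have hm' : ∀ k, MeasurableSet {ω | Nat.count (p ω) k ≤ l ∧ p ω k} := fun k => (hm k).inter (hp k)
  have hi : ∀ {P : Ω → Prop} [DecidablePred P], MeasurableSet {ω | P ω} →
      (AEMeasurable (fun ω => if P ω then (1 : ℝ≥0∞) else 0) μ ∧
      ∫⁻ ω, (if P ω then 1 else 0) ∂μ = μ {ω | P ω}) := fun {P} _ hs => by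
    have : (fun ω => if P ω then (1 : ℝ≥0∞) else 0) = {ω | P ω}.indicator 1 := by
      funext ω
      simp [Set.indicator_apply]
    rw [this]
    exact ⟨(measurable_one.indicator hs).aemeasurable, lintegral_indicator_one hs⟩
  rw [lintegral_tsum fun k => (hi (hm k)).1]
  calc ∑' k, ∫⁻ ω, (if Nat.count (p ω) k ≤ l then 1 else 0) ∂μ
      = ∑' k, μ {ω | Nat.count (p ω) k ≤ l} := tsum_congr fun k => (hi (hm k)).2
    _ ≤ ∑' k, c * μ {ω | Nat.count (p ω) k ≤ l ∧ p ω k} :=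
        ENNReal.tsum_le_tsum fun k => h k l
    _ = c * ∑' k, ∫⁻ ω, (if Nat.count (p ω) k ≤ l ∧ p ω k then 1 else 0) ∂μ := by
        rw [ENNReal.tsum_mul_left]
        exact congrArg _ (tsum_congr fun k => (hi (hm' k)).2.symm)
    _ = c * ∫⁻ ω, ∑' k, (if Nat.count (p ω) k ≤ l ∧ p ω k then 1 else 0) ∂μ := by
        rw [lintegral_tsum fun k => (hi (hm' k)).1]
    _ ≤ c * ∫⁻ _, ((l + 1 : ℕ) : ℝ≥0∞) ∂μ := by
        gcongr with ω
        exact tsum_occurrence_le (p ω) l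
    _ = _ := by rw [lintegral_const, mul_assoc]

/-! ### Conditional laws -/

section Law

variable {Ω : Type*} [MeasurableSpace Ω] {μ : Measure Ω} {A : Matrix (Fin n) (Fin d) ℝ} {b : E n}
  {x₀ : E d} {φ : E d → PMF (E n)} {x : ℕ → Ω → E d} {w : ℕ → Ω → E n}

theorem measurable_stepFn (A : Matrix (Fin n) (Fin d) ℝ) (b : E n) {X : Ω → E d} {W : Ω → E n}
    (hX : Measurable X) (hW : Measurable W) : Measurable fun ω => stepFn A b (X ω) (W ω) := by
  have h1 : Measurable (mulA A) := (LinearMap.continuous_of_finiteDimensional (mulA A)).measurable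
  have h2 : Measurable (mulAT A) := (LinearMap.continuous_of_finiteDimensional (mulAT A)).measurable
  have h3 := h1.comp hX
  have h4 := h2.comp hW
  simp only [Function.comp_def] at h3 h4
  unfold stepFn
  exact hX.add (((hW.inner (measurable_const.sub h3)).div (h4.norm.pow_const 2)).smul h4)

theorem measurable_iterate (hinit : ∀ ω, x 0 ω = x₀)
    (hupdate : ∀ k ω, x (k + 1) ω = stepFn A b (x k ω) (w k ω)) (k : ℕ)
    (hw : ∀ j < k, Measurable (w j)) : Measurable (x k) := by
  induction k with
  | zero => exact (funext hinit : x 0 = fun _ => x₀) ▸ measurable_const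
  | succ k ih =>
    rw [(funext (hupdate k) : x (k + 1) = _)]
    exact measurable_stepFn A b (ih fun j hj => hw j (by omega)) (hw k (by omega))

theorem Generates.step (hgen : Generates μ A b x₀ (ofStep φ) x w) (k : ℕ) (ω : Ω) :
    x (k + 1) ω = stepFn A b (x k ω) (w k ω) := hgen.update k ω

theorem Generates.measurable_iterate (hgen : Generates μ A b x₀ (ofStep φ) x w) (k : ℕ) :
    Measurable (x k) :=
  AdaptiveKaczmarz.measurable_iterate hgen.init hgen.step k fun j _ => hgen.measurable j

theorem Generates.measurableSet_history (hgen : Generates μ A b x₀ (ofStep φ) x w) (k : ℕ)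
    (h : Fin (k + 1) → E d) : MeasurableSet {ω | ∀ j : Fin (k + 1), x j ω = h j} := by
  rw [Set.ofPred_forall]
  exact MeasurableSet.iInter fun j => hgen.measurable_iterate j (measurableSet_singleton (h j))

/-- An event determined by `x_0, …, x_k` on which `w_k` lies in `B x_k` with conditional
probability at least `1 / c`. -/
theorem Generates.measure_le_of_law (hgen : Generates μ A b x₀ (ofStep φ) x w) {k : ℕ}
    {S : Set (Fin (k + 1) → E d)} (hS : S.Countable)
    (hxS : ∀ᵐ ω ∂μ, (fun j : Fin (k + 1) => x j ω) ∈ S) {G : Set Ω}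
    (hG : ∀ ω ω', (∀ j : Fin (k + 1), x j ω = x j ω') → ω ∈ G → ω' ∈ G)
    {B : E d → Set (E n)} (hB : ∀ y, (B y).Countable) {c : ℝ≥0∞}
    (hc : ∀ ω ∈ G, 1 ≤ c * (φ (x k ω)).toOuterMeasure (B (x k ω))) :
    μ G ≤ c * μ (G ∩ {ω | w k ω ∈ B (x k ω)}) := by
  -- Split `G` into the events of a fixed history. Only countably many matter, and keeping those
  -- that occur in `G` makes `hc` available on each of them.
  obtain ⟨D, hD⟩ : ∃ D : (Fin (k + 1) → E d) → Set Ω,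
    D = fun h => {ω | ∀ j : Fin (k + 1), x j ω = h j} := ⟨_, rfl⟩
  have hDm : ∀ h, MeasurableSet (D h) := fun h => hD ▸ hgen.measurableSet_history k h
  obtain ⟨S', hS'⟩ : ∃ S', S' = S ∩ (fun ω (j : Fin (k + 1)) => x j ω) '' G := ⟨_, rfl⟩
  have hS'c : S'.Countable := hS' ▸ hS.mono Set.inter_subset_left
  have h1 : μ G ≤ ∑' h : S', μ (D h) := by
    have : Countable S' := hS'c.to_subtype
    refine le_trans (measure_mono_ae ?_) (measure_iUnion_le fun h : S' => D h)
    filter_upwards [hxS] with ω hω hωG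
    refine Set.mem_iUnion.2 ⟨⟨fun j => x j ω, hS' ▸ ⟨hω, ω, hωG, rfl⟩⟩, ?_⟩
    rw [hD]
    exact fun j => rfl
  have h2 : ∀ h ∈ S', μ (D h) ≤ c * μ (D h ∩ {ω | w k ω ∈ B (h (Fin.last k))}) := by
    intro h hh
    rw [hS'] at hh
    obtain ⟨-, ω, hωG, rfl⟩ := hh
    have h3 : μ (D fun j => x j ω) * (φ (x k ω)).toOuterMeasure (B (x k ω)) ≤
        μ (D (fun j => x j ω) ∩ {ω' | w k ω' ∈ B (x k ω)}) := by
      have hBc : Countable (B (x k ω)) := (hB _).to_subtype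
      rw [PMF.toOuterMeasure_apply, ← tsum_subtype, ← ENNReal.tsum_mul_left]
      have h4 : ∀ v : B (x k ω), μ (D fun j => x j ω) * φ (x k ω) v =
          μ (D (fun j => x j ω) ∩ {ω' | w k ω' = v}) := fun v => by
        have := hgen.law k (fun j => x j ω) v
        rw [hD]
        exact this.symm
      simp_rw [h4]
      rw [← measure_iUnion]
      · refine measure_mono (Set.iUnion_subset ?_)
        rintro v ω' ⟨h5, h6⟩
        refine ⟨h5, ?_⟩
        rw [Set.mem_ofPred_eq] at h6 ⊢
        rw [h6]
        exact v.2
      · intro v v' hne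
        refine Set.disjoint_left.2 ?_
        rintro ω' ⟨-, h5⟩ ⟨-, h6⟩
        exact hne (Subtype.ext ((show w k ω' = v from h5).symm.trans h6))
      · exact fun v => (hDm _).inter (hgen.measurable k (measurableSet_singleton _))
    calc μ (D fun j => x j ω) = 1 * μ (D fun j => x j ω) := (one_mul _).symm
      _ ≤ c * (φ (x k ω)).toOuterMeasure (B (x k ω)) * μ (D fun j => x j ω) := by
          gcongr
          exact hc ω hωG
      _ = c * (μ (D fun j => x j ω) * (φ (x k ω)).toOuterMeasure (B (x k ω))) := by ring
      _ ≤ _ := by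
          gcongr
          exact h3
  calc μ G ≤ ∑' h : S', μ (D h) := h1
    _ ≤ ∑' h : S', c * μ (D h ∩ {ω | w k ω ∈ B ((h : Fin (k + 1) → E d) (Fin.last k))}) :=
        ENNReal.tsum_le_tsum fun h => h2 h h.2
    _ = c * μ (⋃ h : S', D h ∩ {ω | w k ω ∈ B ((h : Fin (k + 1) → E d) (Fin.last k))}) := by
        have : Countable S' := hS'c.to_subtype
        rw [ENNReal.tsum_mul_left, measure_iUnion]
        · intro h h' hne
          refine Set.disjoint_left.2 ?_
          rintro ω ⟨h5, -⟩ ⟨h6, -⟩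
          rw [hD] at h5 h6
          exact hne (Subtype.ext (funext fun j => (h5 j).symm.trans (h6 j)))
        · exact fun h => (hDm _).inter (hgen.measurable k (hB _).measurableSet)
    _ ≤ _ := by
        gcongr
        refine Set.iUnion_subset ?_
        rintro ⟨h, hh⟩ ω ⟨h5, h6⟩
        rw [hS'] at hh
        obtain ⟨-, ω', hω', rfl⟩ := hh
        rw [hD] at h5
        refine ⟨hG ω' ω (fun j => (h5 j).symm) hω', ?_⟩
        have : x k ω = x k ω' := h5 (Fin.last k)
        rw [Set.mem_ofPred_eq, this]
        exact h6

theorem Generates.ae_mem_of_history [IsProbabilityMeasure μ]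
    (hgen : Generates μ A b x₀ (ofStep φ) x w) {T : Set (E n)} (hT : T.Countable)
    (hφT : ∀ y, (φ y).support ⊆ T) {k : ℕ} {S : Set (Fin (k + 1) → E d)} (hS : S.Countable)
    (hxS : ∀ᵐ ω ∂μ, (fun j : Fin (k + 1) => x j ω) ∈ S) : ∀ᵐ ω ∂μ, w k ω ∈ T := by
  have h1 := hgen.measure_le_of_law hS hxS (G := Set.univ) (fun _ _ _ _ => Set.mem_univ _)
    (B := fun _ => T) (fun _ => hT) (c := 1) (fun ω _ => by
      rw [(PMF.toOuterMeasure_apply_eq_one_iff _ _).2 (hφT _), one_mul])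
  rw [measure_univ, one_mul, Set.univ_inter] at h1
  have hm : MeasurableSet {ω | w k ω ∈ T} := hgen.measurable k hT.measurableSet
  exact (prob_compl_eq_zero_iff hm).2 (le_antisymm prob_le_one h1)

/-- Induction in tandem with `Generates.ae_mem_of_history`: a countable set of histories up to k
forces `w k` into `T`, and then the next iterate has countably many values. -/
theorem Generates.exists_countable_history [IsProbabilityMeasure μ]
    (hgen : Generates μ A b x₀ (ofStep φ) x w) {T : Set (E n)} (hT : T.Countable)
    (hφT : ∀ y, (φ y).support ⊆ T) (k : ℕ) :
    ∃ S : Set (Fin (k + 1) → E d), S.Countable ∧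
      ∀ᵐ ω ∂μ, (fun j : Fin (k + 1) => x j ω) ∈ S := by
  induction k with
  | zero =>
    refine ⟨{fun _ => x₀}, Set.countable_singleton _, Filter.Eventually.of_forall fun ω => ?_⟩
    exact funext fun j => by rw [Fin.fin_one_eq_zero j]; exact hgen.init ω
  | succ k ih =>
    obtain ⟨S, hS, hxS⟩ := ih
    refine ⟨Set.image2 (fun h v => Fin.snoc (α := fun _ => E d) h
      (stepFn A b (h (Fin.last k)) v)) S T, hS.image2 hT _, ?_⟩
    filter_upwards [hxS, hgen.ae_mem_of_history hT hφT hS hxS] with ω h1 h2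
    refine ⟨_, h1, _, h2, funext fun j => ?_⟩
    beta_reduce
    refine Fin.lastCases ?_ (fun j => ?_) j
    · rw [Fin.snoc_last]
      exact (hgen.step k ω).symm
    · rw [Fin.snoc_castSucc, Fin.val_castSucc]

/-- This ties the realised directions to those entering `gramDets`, as needed when the rate is 0. -/
theorem Generates.ae_mem_support [IsProbabilityMeasure μ]
    (hgen : Generates μ A b x₀ (ofStep φ) x w) {T : Set (E n)} (hT : T.Countable)
    (hφT : ∀ y, (φ y).support ⊆ T) : ∀ᵐ ω ∂μ, ∀ k, w k ω ∈ (φ (x k ω)).support := by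
  rw [ae_all_iff]
  intro k
  obtain ⟨S, hS, hxS⟩ := hgen.exists_countable_history hT hφT k
  have hnull : ∀ᵐ ω ∂μ, ∀ h ∈ S, ∀ v ∈ T, v ∉ (φ (h (Fin.last k))).support →
      ¬((∀ j : Fin (k + 1), x j ω = h j) ∧ w k ω = v) := by
    rw [ae_ball_iff hS]
    intro h _
    rw [ae_ball_iff hT]
    intro v _
    by_cases hv : v ∈ (φ (h (Fin.last k))).support
    · exact Filter.Eventually.of_forall fun ω hv' => absurd hv hv'
    · have h0 := hgen.law k h v
      rw [ofStep, (PMF.apply_eq_zero_iff _ _).2 hv, mul_zero] at h0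
      filter_upwards [measure_eq_zero_iff_ae_notMem.1 h0] with ω hω _
      exact hω
  filter_upwards [hnull, hxS, hgen.ae_mem_of_history hT hφT hS hxS] with ω h1 h2 h3
  by_contra h4
  exact h1 _ h2 _ h3 h4 ⟨fun j => rfl, rfl⟩

end Law

/-! ### The rate -/

theorem transpose_mul_self_apply_eq_inner {ι : Type*} (u : ι → E d) (i j : ι) :
    ((Matrix.of fun a (j : ι) => u j a).transpose * Matrix.of fun a (j : ι) => u j a) i j =
      inner ℝ (u i) (u j) := by
  simp [Matrix.mul_apply, PiLp.inner_apply, mul_comm]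

theorem det_transpose_mul_self_pos {ι : Type*} [Fintype ι] [DecidableEq ι] {u : ι → E d}
    (hu : LinearIndependent ℝ u) :
    0 < ((Matrix.of fun a (j : ι) => u j a).transpose * Matrix.of fun a (j : ι) => u j a).det := by
  rw [← Matrix.conjTranspose_eq_transpose_of_trivial]
  refine (Matrix.PosDef.conjTranspose_mul_self _ ?_).det_pos
  rw [Matrix.mulVec_injective_iff]
  exact hu.map' (WithLp.linearEquiv 2 ℝ (Fin d → ℝ)).toLinearMap (LinearEquiv.ker _)

theorem linearIndependent_normalize {ι F : Type*} [NormedAddCommGroup F] [NormedSpace ℝ F]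
    {v : ι → F} (hv : LinearIndependent ℝ v) :
    LinearIndependent ℝ fun j => ‖v j‖⁻¹ • v j :=
  hv.units_smul fun j => Units.mk0 ‖v j‖⁻¹ (inv_ne_zero (norm_ne_zero_iff.2 (hv.ne_zero j)))

theorem pos_of_mem_gramDets {A : Matrix (Fin n) (Fin d) ℝ} {φ : E d → PMF (E n)} {r : ℝ}
    (hr : r ∈ gramDets A φ) : 0 < r := by
  obtain ⟨x, w, S, -, hLI, -, F, rfl, rfl⟩ := hr
  exact det_transpose_mul_self_pos (linearIndependent_normalize hLI)

theorem finite_gramDets (A : Matrix (Fin n) (Fin d) ℝ) {φ : E d → PMF (E n)}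
    (hφ : ∀ x, (φ x).support ⊆ Set.range basisVec) : (gramDets A φ).Finite := by
  let D : (Fin d → E n) → Finset (Fin d) → ℝ := fun w S =>
    ((Matrix.of fun a (j : S) => (‖mulAT A (w j)‖⁻¹ • mulAT A (w j)) a).transpose *
      Matrix.of fun a (j : S) => (‖mulAT A (w j)‖⁻¹ • mulAT A (w j)) a).det
  refine (Set.finite_range fun q : (Fin d → Fin n) × Finset (Fin d) =>
    D (fun j => basisVec (q.1 j)) q.2).subset ?_
  rintro r ⟨x, w, S, hw, -, -, F, rfl, rfl⟩
  choose i hi using fun j => hφ _ (hw j)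
  obtain rfl : (fun j => basisVec (i j)) = w := funext hi
  exact ⟨(i, S), rfl⟩

/-- Take all `w j` equal: the maximal independent subfamily is one unit vector, or empty if the
direction vanishes. -/
theorem one_mem_gramDets (A : Matrix (Fin n) (Fin d) ℝ) (φ : E d → PMF (E n)) :
    1 ∈ gramDets A φ := by
  obtain ⟨w, hw⟩ := (φ 0).support_nonempty
  by_cases hv : mulAT A w = 0
  · refine ⟨fun _ => 0, fun _ => w, ∅, fun _ => hw, linearIndependent_empty_type,
      fun _ => hv ▸ Submodule.zero_mem _, _, rfl, ?_⟩
    rw [Matrix.det_isEmpty]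
  · have hd : 0 < d := by
      by_contra h
      obtain rfl : d = 0 := by omega
      exact hv (Subsingleton.elim _ _)
    refine ⟨fun _ => 0, fun _ => w, {⟨0, hd⟩}, fun _ => hw, ?_, fun _ => ?_, _, rfl, ?_⟩
    · exact LinearIndependent.of_subsingleton (v := fun _ => mulAT A w)
        (⟨⟨0, hd⟩, Finset.mem_singleton_self _⟩ : ({⟨0, hd⟩} : Finset (Fin d))) hv
    · exact Submodule.subset_span ⟨⟨⟨0, hd⟩, Finset.mem_singleton_self _⟩, rfl⟩
    · rw [Matrix.det_unique, transpose_mul_self_apply_eq_inner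
        (u := fun _ : ({⟨0, hd⟩} : Finset (Fin d)) => ‖mulAT A w‖⁻¹ • mulAT A w),
        real_inner_self_eq_norm_sq, norm_smul, norm_inv, norm_norm,
        inv_mul_cancel₀ (norm_ne_zero_iff.2 hv), one_pow]

theorem bddBelow_gramDets (A : Matrix (Fin n) (Fin d) ℝ) (φ : E d → PMF (E n)) :
    BddBelow (gramDets A φ) := ⟨0, fun _ h => (pos_of_mem_gramDets h).le⟩

theorem rate_nonneg (A : Matrix (Fin n) (Fin d) ℝ) (φ : E d → PMF (E n)) : 0 ≤ rate A φ :=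
  sub_nonneg.2 (csInf_le (bddBelow_gramDets A φ) (one_mem_gramDets A φ))

/-- The selected vectors are basis vectors, so the set of determinants is finite and its infimum is
one of its positive members. -/
theorem rate_lt_one (A : Matrix (Fin n) (Fin d) ℝ) {φ : E d → PMF (E n)}
    (hφ : ∀ x, (φ x).support ⊆ Set.range basisVec) : rate A φ < 1 :=
  sub_lt_self _ (pos_of_mem_gramDets
    (Set.Nonempty.csInf_mem ⟨1, one_mem_gramDets A φ⟩ (finite_gramDets A hφ)))

/-- A pair of independent directions contributes the squared sine of their angle. -/
theorem pair_mem_gramDets {A : Matrix (Fin n) (Fin d) ℝ} {φ : E d → PMF (E n)} {y y' : E d}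
    {w w' : E n} (hw : w ∈ (φ y).support) (hw' : w' ∈ (φ y').support)
    (hLI : LinearIndependent ℝ ![mulAT A w, mulAT A w']) :
    1 - inner ℝ (‖mulAT A w‖⁻¹ • mulAT A w) (‖mulAT A w'‖⁻¹ • mulAT A w') ^ 2 ∈ gramDets A φ := by
  have hd : 2 ≤ d := by simpa using hLI.fintype_card_le_finrank
  let S : Finset (Fin d) := Finset.univ.filter fun j => j.val < 2
  -- The two directions occupy places 0 and 1; the remaining places repeat `w'`, so the pair is a
  -- maximal independent subfamily.
  let W : Fin d → E n := fun j => if j.val = 0 then w else w'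
  let e : Fin 2 ≃ S :=
    { toFun := fun i => ⟨⟨i, i.2.trans_le hd⟩, Finset.mem_filter.2 ⟨Finset.mem_univ _, i.2⟩⟩
      invFun := fun j => ⟨j.1.1, (Finset.mem_filter.1 j.2).2⟩
      left_inv := fun i => rfl
      right_inv := fun j => rfl }
  have he : (fun j : S => mulAT A (W j)) ∘ e = ![mulAT A w, mulAT A w'] := by
    funext i
    fin_cases i <;> simp [e, W]
  refine ⟨fun j => if j.val = 0 then y else y', W, S, fun j => ?_, ?_, fun j => ?_, _, rfl, ?_⟩
  · by_cases hj : j.val = 0 <;> simpa [W, hj]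
  · rw [← linearIndependent_equiv e, he]
    exact hLI
  · refine Submodule.subset_span ?_
    by_cases hj : j.val = 0
    · exact ⟨e 0, by simp [W, hj, e]⟩
    · exact ⟨e 1, by simp [W, hj, e]⟩
  · rw [← Matrix.det_submatrix_equiv_self e, Matrix.det_fin_two]
    simp only [Matrix.submatrix_apply]
    rw [transpose_mul_self_apply_eq_inner (u := fun j : S => ‖mulAT A (W j)‖⁻¹ • mulAT A (W j)),
      transpose_mul_self_apply_eq_inner (u := fun j : S => ‖mulAT A (W j)‖⁻¹ • mulAT A (W j)),
      transpose_mul_self_apply_eq_inner (u := fun j : S => ‖mulAT A (W j)‖⁻¹ • mulAT A (W j)),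
      transpose_mul_self_apply_eq_inner (u := fun j : S => ‖mulAT A (W j)‖⁻¹ • mulAT A (W j))]
    have h0 : mulAT A (W (e 0)) = mulAT A w := congrFun he 0
    have h1 : mulAT A (W (e 1)) = mulAT A w' := congrFun he 1
    have hu : ∀ v : E d, v ≠ 0 → inner ℝ (‖v‖⁻¹ • v) (‖v‖⁻¹ • v) = 1 := fun v hv => by
      rw [real_inner_self_eq_norm_sq, norm_smul, norm_inv, norm_norm,
        inv_mul_cancel₀ (norm_ne_zero_iff.2 hv), one_pow]
    rw [h0, h1, hu _ (show mulAT A w ≠ 0 from hLI.ne_zero 0),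
      hu _ (show mulAT A w' ≠ 0 from hLI.ne_zero 1),
      real_inner_comm (‖mulAT A w‖⁻¹ • mulAT A w)]
    ring

/-- Rate 0 means that the infimum is 1, while an independent pair contributes 1 - cos² of its angle;
hence the cosine vanishes. -/
theorem orthogonal_or_parallel_of_rate_eq_zero {A : Matrix (Fin n) (Fin d) ℝ}
    {φ : E d → PMF (E n)} (hrate : rate A φ = 0) {y y' : E d} {w w' : E n}
    (hw : w ∈ (φ y).support) (hw' : w' ∈ (φ y').support) :
    inner ℝ (mulAT A w) (mulAT A w') = 0 ∨ ∃ t : ℝ, t • mulAT A w' = mulAT A w := by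
  by_cases hLI : LinearIndependent ℝ ![mulAT A w', mulAT A w]
  · left
    have h1 : sInf (gramDets A φ) ≤ _ :=
      csInf_le (bddBelow_gramDets A φ) (pair_mem_gramDets hw' hw hLI)
    have h2 : sInf (gramDets A φ) = 1 := by
      rw [rate] at hrate
      linarith
    have h3 : inner ℝ (‖mulAT A w'‖⁻¹ • mulAT A w') (‖mulAT A w‖⁻¹ • mulAT A w) = 0 :=
      pow_eq_zero_iff two_ne_zero |>.1 (le_antisymm (by linarith) (sq_nonneg _))
    rw [inner_smul_left, inner_smul_right, real_inner_comm] at h3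
    simpa [hLI.ne_zero 0, hLI.ne_zero 1,
      show mulAT A w' ≠ 0 from hLI.ne_zero 0, show mulAT A w ≠ 0 from hLI.ne_zero 1] using h3
  · by_cases h0 : mulAT A w' = 0
    · left
      rw [h0, inner_zero_right]
    · right
      rw [LinearIndependent.pair_iff' h0] at hLI
      push Not at hLI
      exact hLI

/-! ### Projections along orthogonal or parallel directions -/

section Orthogonal

variable {F : Type*} [NormedAddCommGroup F] [InnerProductSpace ℝ F]

/-- A projection along v_k makes the iterate orthogonal to v_k and to every multiple of it, and does
not disturb orthogonality to vectors orthogonal to v_k. -/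
theorem inner_iterate_eq_zero {v y : ℕ → F}
    (hy : ∀ k, y (k + 1) = y k - (inner ℝ (v k) (y k) / ‖v k‖ ^ 2) • v k)
    (hv : ∀ j k, inner ℝ (v j) (v k) = 0 ∨ ∃ t : ℝ, t • v k = v j) {j k : ℕ} (hjk : j < k) :
    inner ℝ (v j) (y k) = 0 := by
  have hself : ∀ k, inner ℝ (v k) (y (k + 1)) = 0 := by
    intro k
    by_cases h0 : v k = 0
    · rw [h0, inner_zero_left]
    · rw [hy, inner_sub_right, inner_smul_right, real_inner_self_eq_norm_sq,
        div_mul_cancel₀ _ (pow_ne_zero 2 (norm_ne_zero_iff.2 h0)), sub_self]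
  induction k with
  | zero => omega
  | succ k ih =>
    rcases hv j k with h | ⟨t, ht⟩
    · rcases Nat.lt_succ_iff_lt_or_eq.1 hjk with hlt | rfl
      · rw [hy, inner_sub_right, inner_smul_right, h, ih hlt, mul_zero, sub_zero]
      · exact hself j
    · rw [← ht, inner_smul_left, hself, mul_zero]

open Classical in
-- The iterate is orthogonal to all earlier directions. If v_k lies in their span, the step does not
-- move, which is no contraction while the iterate is nonzero. So each contraction raises the
-- dimension of the span.
theorem count_le_finrank_span [FiniteDimensional ℝ F] {v y : ℕ → F}
    (hy : ∀ k, y (k + 1) = y k - (inner ℝ (v k) (y k) / ‖v k‖ ^ 2) • v k)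
    (hv : ∀ j k, inner ℝ (v j) (v k) = 0 ∨ ∃ t : ℝ, t • v k = v j) {g : ℝ} (hg : g < 1)
    (k : ℕ) (hk : y k ≠ 0) :
    Nat.count (fun j => ‖y (j + 1)‖ ^ 2 ≤ g * ‖y j‖ ^ 2) k ≤
      Module.finrank ℝ (Submodule.span ℝ (v '' Set.Iio k)) := by
  induction k with
  | zero => simp
  | succ k ih =>
    have hk' : y k ≠ 0 := fun h => hk (by rw [hy, h, inner_zero_right]; simp)
    have hle : Submodule.span ℝ (v '' Set.Iio k) ≤ Submodule.span ℝ (v '' Set.Iio (k + 1)) :=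
      Submodule.span_mono (Set.image_mono (Set.Iio_subset_Iio (Nat.le_succ k)))
    rw [Nat.count_succ]
    split_ifs with hc
    · refine Nat.succ_le_of_lt ((ih hk').trans_lt (Submodule.finrank_lt_finrank_of_lt ?_))
      refine lt_of_le_of_ne hle fun heq => ?_
      have hmem : v k ∈ Submodule.span ℝ (v '' Set.Iio k) :=
        heq ▸ Submodule.subset_span ⟨k, Nat.lt_succ_self k, rfl⟩
      have hperp : y k ∈ (Submodule.span ℝ (v '' Set.Iio k))ᗮ := by
        refine Submodule.mem_orthogonal _ _ |>.2 fun u hu => ?_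
        induction hu using Submodule.span_induction with
        | mem u hu =>
          obtain ⟨j, hj, rfl⟩ := hu
          exact inner_iterate_eq_zero hy hv hj
        | zero => exact inner_zero_left _
        | add u u' _ _ h h' => rw [inner_add_left, h, h', add_zero]
        | smul a u _ h => rw [inner_smul_left, h, mul_zero]
      have h0 : inner ℝ (v k) (y k) = 0 := hperp _ hmem
      rw [hy, h0, zero_div, zero_smul, sub_zero] at hc
      have : 0 < ‖y k‖ ^ 2 := pow_pos (norm_pos_iff.2 hk') 2
      nlinarith
    · exact (ih hk').trans (Submodule.finrank_mono hle)

end Orthogonal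

/-! ### Convergence -/

open Classical in
theorem le_pow_count_mul {a : ℕ → ℝ} {g : ℝ} (hg : 0 ≤ g) (hmono : ∀ k, a (k + 1) ≤ a k) (k : ℕ) :
    a k ≤ g ^ Nat.count (fun j => a (j + 1) ≤ g * a j) k * a 0 := by
  induction k with
  | zero => simp
  | succ k ih =>
    rw [Nat.count_succ]
    split_ifs with h
    · calc a (k + 1) ≤ g * a k := h
        _ ≤ g * (g ^ Nat.count (fun j => a (j + 1) ≤ g * a j) k * a 0) := by gcongr
        _ = _ := by rw [pow_succ]; ring
    · exact (hmono k).trans ih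

/-- The σ-algebra is a parameter so that the result serves both the ambient space and the stages of
the natural filtration: the event at `j` involves only `w 0, …, w j`. -/
theorem measurableSet_contraction {Ω : Type*} [m : MeasurableSpace Ω]
    {A : Matrix (Fin n) (Fin d) ℝ} {b : E n} {x₀ : E d} {x : ℕ → Ω → E d} {w : ℕ → Ω → E n}
    (hinit : ∀ ω, x 0 ω = x₀) (hupdate : ∀ k ω, x (k + 1) ω = stepFn A b (x k ω) (w k ω))
    (z : E d) (g : ℝ) (j : ℕ) (hw : ∀ i < j + 1, Measurable (w i)) :
    MeasurableSet {ω | ‖x (j + 1) ω - z‖ ^ 2 ≤ g * ‖x j ω - z‖ ^ 2} := by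
  have h1 := measurable_iterate hinit hupdate (j + 1) hw
  have h2 := measurable_iterate hinit hupdate j fun i hi => hw i (by omega)
  exact measurableSet_le ((h1.sub_const z).norm.pow_const 2)
    (((h2.sub_const z).norm.pow_const 2).const_mul g)

section

variable {Ω : Type*} [MeasurableSpace Ω] {μ : Measure Ω} {A : Matrix (Fin n) (Fin d) ℝ} {b : E n}
  {x₀ : E d} {φ : E d → PMF (E n)} {x : ℕ → Ω → E d} {w : ℕ → Ω → E n}

theorem Generates.sub_mem (hgen : Generates μ A b x₀ (ofStep φ) x w) {z : E d}
    (hz : mulA A z = b) (hx₀ : x₀ - z ∈ (mulA A).kerᗮ) (k : ℕ) (ω : Ω) :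
    x k ω - z ∈ (mulA A).kerᗮ := by
  induction k with
  | zero => rwa [hgen.init]
  | succ k ih =>
    rw [hgen.step]
    exact stepFn_sub_mem hz ih _

open Classical in
/-- If every step contracts the squared error by the factor `g` with conditional probability at
least `1 / c`, and if `M ℓ` contractions yield the factor `γ ^ ℓ`, then the times of the
contractions with numbers `M, 2 M, …` show convergence with rate `γ` and constant `M c`. -/
theorem Generates.convergesAlong [IsProbabilityMeasure μ]
    (hgen : Generates μ A b x₀ (ofStep φ) x w) (hsol : ∃ xs, mulA A xs = b)
    (hφ : ∀ y, (φ y).support ⊆ Set.range basisVec) {g : ℝ} {c : ℝ≥0}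
    (hc : ∀ y, y - projSol A b x₀ ∈ (mulA A).kerᗮ → 1 ≤ (c : ℝ≥0∞) *
      (φ y).toOuterMeasure {v | v ∈ Set.range basisVec ∧
        ‖stepFn A b y v - projSol A b x₀‖ ^ 2 ≤ g * ‖y - projSol A b x₀‖ ^ 2})
    {M : ℕ} (hM : 0 < M) {γ : ℝ}
    (hγ : ∀ᵐ ω ∂μ, ∀ k l, M * (l + 1) ≤ Nat.count (fun j =>
      ‖x (j + 1) ω - projSol A b x₀‖ ^ 2 ≤ g * ‖x j ω - projSol A b x₀‖ ^ 2) k →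
      ‖x k ω - projSol A b x₀‖ ^ 2 ≤ γ ^ (l + 1) * ‖x₀ - projSol A b x₀‖ ^ 2) :
    ConvergesAlong μ A b x₀ x w hgen.measurable γ (M * c) := by
  obtain ⟨z, hzdef⟩ : ∃ z, z = projSol A b x₀ := ⟨_, rfl⟩
  have hz : mulA A z = b := hzdef ▸ mulA_projSol hsol x₀
  have hx₀ : x₀ - z ∈ (mulA A).kerᗮ := hzdef ▸ sub_projSol_mem hsol x₀
  unfold ConvergesAlong
  rw [← hzdef] at hc hγ ⊢
  obtain ⟨p, hp⟩ : ∃ p : Ω → ℕ → Prop,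
    p = fun ω j => ‖x (j + 1) ω - z‖ ^ 2 ≤ g * ‖x j ω - z‖ ^ 2 := ⟨_, rfl⟩
  have hM1 : ∀ l, M * (l + 1) - 1 + 1 = M * (l + 1) := fun l =>
    Nat.sub_add_cancel (Nat.mul_pos hM l.succ_pos)
  have hpm : ∀ j, MeasurableSet {ω | p ω j} := fun j => by
    rw [hp]
    exact measurableSet_contraction hgen.init hgen.step z g j fun i _ => hgen.measurable i
  have hT : (Set.range (basisVec : Fin n → E n)).Countable := Set.countable_range _
  have hcond : ∀ k l, μ {ω | Nat.count (p ω) k ≤ l} ≤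
      c * μ {ω | Nat.count (p ω) k ≤ l ∧ p ω k} := by
    intro k l
    obtain ⟨S, hS, hxS⟩ := hgen.exists_countable_history hT hφ k
    refine (hgen.measure_le_of_law hS hxS (G := {ω | Nat.count (p ω) k ≤ l}) ?_
      (B := fun y => {v | v ∈ Set.range basisVec ∧
        ‖stepFn A b y v - z‖ ^ 2 ≤ g * ‖y - z‖ ^ 2}) (fun y => hT.mono fun v hv => hv.1)
      fun ω _ => hc _ (hgen.sub_mem hz hx₀ k ω)).trans ?_
    -- The contractions before time k involve only the iterates up to x_k, so the event is
    -- determined by the history.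
    · intro ω ω' h hω
      have : Nat.count (p ω') k = Nat.count (p ω) k := by
        rw [Nat.count_eq_card_filter_range, Nat.count_eq_card_filter_range]
        refine congrArg _ (Finset.filter_congr fun j hj => ?_)
        have hj := Finset.mem_range.1 hj
        have h1 : x j ω = x j ω' := h ⟨j, by omega⟩
        have h2 : x (j + 1) ω = x (j + 1) ω' := h ⟨j + 1, by omega⟩
        rw [hp]
        simp only [h1, h2]
      rw [Set.mem_ofPred_eq, this]
      exact hω
    · gcongr
      rintro ω ⟨h1, h2⟩
      refine ⟨h1, ?_⟩
      rw [hp]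
      simp only [hgen.step]
      exact h2.2
  have hmean := lintegral_tsum_count_le hpm hcond
  -- Occurrences are numbered from 0, so contraction number M (l + 1) has index M (l + 1) - 1; its
  -- effect is visible in the iterate one step after this time.
  refine ⟨fun l ω => nthTime (p ω) (M * (l + 1) - 1), ?_, ?_, ?_, ?_⟩
  · intro l i
    have : {ω | nthTime (p ω) (M * (l + 1) - 1) ≤ (i : ℕ∞)} =
        {ω | M * (l + 1) - 1 < Nat.count (p ω) (i + 1)} := by
      ext ω
      exact nthTime_le_iff _ _ _
    let ℱ := Filtration.natural w fun k => (hgen.measurable k).stronglyMeasurable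
    change MeasurableSet[ℱ i] {ω | nthTime (p ω) (M * (l + 1) - 1) ≤ (i : ℕ∞)}
    rw [this]
    refine measurableSet_lt_count (m := ℱ i) (fun j hj => ?_) _
    rw [hp]
    refine measurableSet_contraction (m := ℱ i) hgen.init hgen.step z g j
      fun i' hi' => ?_
    exact ((Filtration.stronglyAdapted_natural fun k => (hgen.measurable k).stronglyMeasurable)
      i').measurable.mono (Filtration.mono _ (by omega)) le_rfl
  · intro l ω
    have : M * (l + 1) - 1 < M * (l + 1 + 1) - 1 := by
      have := hM1 l
      have := hM1 (l + 1)
      have : M * (l + 1 + 1) = M * (l + 1) + M := by ring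
      omega
    exact ⟨nthTime_le_nthTime this, nthTime_lt_nthTime this⟩
  · have hfin : ∀ᵐ ω ∂μ, ∀ l, nthTime (p ω) l ≠ ⊤ := by
      rw [ae_all_iff]
      intro l
      have hmeas : Measurable fun ω => ∑' k, if Nat.count (p ω) k ≤ l then (1 : ℝ≥0∞) else 0 := by
        refine Measurable.tsum fun k => Measurable.ite ?_ measurable_const measurable_const
        simpa [Set.compl_ofPred] using (measurableSet_lt_count (k := k) (fun j _ => hpm j) l).compl
      have hne : ∫⁻ ω, ∑' k, (if Nat.count (p ω) k ≤ l then 1 else 0) ∂μ ≠ ⊤ := by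
        refine ne_top_of_le_ne_top ?_ (hmean l)
        rw [measure_univ, mul_one]
        exact ENNReal.mul_ne_top ENNReal.coe_ne_top (ENNReal.natCast_ne_top _)
      filter_upwards [ae_lt_top hmeas hne] with ω hω h
      have := (coe_nthTime_le_tsum (p ω) l).trans_lt hω
      rw [h] at this
      simp at this
    filter_upwards [hfin, hγ] with ω h1 h2
    -- Early termination needs no separate case: at the solution z a contraction reads 0 ≤ g · 0, so
    -- the times go on and stay finite.
    right
    intro l
    obtain ⟨m, hm⟩ := ENat.ne_top_iff_exists.1 (h1 (M * (l + 1) - 1))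
    refine ⟨m, hm.symm, h2 _ _ ?_⟩
    have := (nthTime_le_iff _ _ _).1 hm.symm.le
    rw [hp] at this
    have h3 := hM1 l
    exact h3 ▸ Nat.succ_le_of_lt this
  · intro l
    calc ∫⁻ ω, (nthTime (p ω) (M * (l + 1) - 1) : ℝ≥0∞) ∂μ
        ≤ ∫⁻ ω, ∑' k, (if Nat.count (p ω) k ≤ M * (l + 1) - 1 then 1 else 0) ∂μ :=
          lintegral_mono fun ω => coe_nthTime_le_tsum _ _
      _ ≤ c * ((M * (l + 1) - 1 + 1 : ℕ) : ℝ≥0∞) * μ Set.univ := hmean _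
      _ = _ := by
          rw [hM1, measure_univ, mul_one]
          push_cast
          ring

theorem Generates.norm_sq_sub_antitone (hgen : Generates μ A b x₀ (ofStep φ) x w) {z : E d}
    (hz : mulA A z = b) (k : ℕ) (ω : Ω) : ‖x (k + 1) ω - z‖ ^ 2 ≤ ‖x k ω - z‖ ^ 2 := by
  rw [hgen.step]
  exact norm_sq_stepFn_sub_le hz _ _

open Classical in
theorem Generates.norm_sq_sub_le_pow_count (hgen : Generates μ A b x₀ (ofStep φ) x w) {z : E d}
    (hz : mulA A z = b) {g : ℝ} (hg0 : 0 ≤ g) (hg1 : g ≤ 1) {γ : ℝ} {M : ℕ} (hM : g ^ M ≤ γ)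
    (ω : Ω) (k l : ℕ) (hk : M * (l + 1) ≤ Nat.count (fun j =>
      ‖x (j + 1) ω - z‖ ^ 2 ≤ g * ‖x j ω - z‖ ^ 2) k) :
    ‖x k ω - z‖ ^ 2 ≤ γ ^ (l + 1) * ‖x₀ - z‖ ^ 2 := by
  have h := le_pow_count_mul (a := fun k => ‖x k ω - z‖ ^ 2) hg0
    (fun k => hgen.norm_sq_sub_antitone hz k ω) k
  simp only [hgen.init] at h
  refine h.trans (mul_le_mul_of_nonneg_right ?_ (sq_nonneg _))
  calc _ ≤ g ^ (M * (l + 1)) := pow_le_pow_of_le_one hg0 hg1 hk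
    _ = (g ^ M) ^ (l + 1) := pow_mul _ _ _
    _ ≤ γ ^ (l + 1) := pow_le_pow_left₀ (pow_nonneg hg0 _) hM _

open Classical in
/-- If all directions are orthogonal or parallel, more than `d` contractions lead to a solution. -/
theorem Generates.eq_of_dim_lt_count (hgen : Generates μ A b x₀ (ofStep φ) x w) {z : E d}
    (hz : mulA A z = b) (hrate : rate A φ = 0) {g : ℝ} (hg1 : g < 1) {ω : Ω}
    (hω : ∀ k, w k ω ∈ (φ (x k ω)).support) {k : ℕ} (hk : d < Nat.count (fun j =>
      ‖x (j + 1) ω - z‖ ^ 2 ≤ g * ‖x j ω - z‖ ^ 2) k) : x k ω - z = 0 := by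
  by_contra hne
  have h1 := count_le_finrank_span (v := fun k => mulAT A (w k ω)) (y := fun k => x k ω - z)
    (fun k => by rw [hgen.step, stepFn_sub hz])
    (fun j k => orthogonal_or_parallel_of_rate_eq_zero hrate (hω j) (hω k)) hg1 k hne
  have h2 := Submodule.finrank_le
    (Submodule.span ℝ ((fun k => mulAT A (w k ω)) '' Set.Iio k))
  rw [finrank_euclideanSpace_fin] at h2
  omega

end

/-! ### From the selection rules to the rates -/

theorem IsMethod.exists_contraction {A : Matrix (Fin n) (Fin d) ℝ} {b : E n}
    (hsol : ∃ xs, mulA A xs = b) {φ : E d → PMF (E n)} {c : ℝ≥0} (hφ : IsMethod A b φ c) :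
    ∃ g : ℝ, 0 ≤ g ∧ g < 1 ∧ ∀ z, mulA A z = b → ∀ y, y - z ∈ (mulA A).kerᗮ →
      1 ≤ (c : ℝ≥0∞) * (φ y).toOuterMeasure {v | v ∈ Set.range basisVec ∧
        ‖stepFn A b y v - z‖ ^ 2 ≤ g * ‖y - z‖ ^ 2} := by
  obtain ⟨C, hC0, hC⟩ := hφ.exists_dominant hsol
  obtain ⟨g, hg0, hg1, hg⟩ := exists_contraction_of_dominant A b hC0
  refine ⟨g, hg0, hg1, fun z hz y hy => (hC y).trans ?_⟩
  gcongr
  rintro _ ⟨i, hi, rfl⟩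
  exact ⟨⟨i, rfl⟩, hg z hz y hy i hi⟩

theorem finrank_rrow_pos {A : Matrix (Fin n) (Fin d) ℝ} {b : E n}
    (hsol : ∃ xs, mulA A xs = b) {x₀ : E d} (hx₀ : mulA A x₀ ≠ b) :
    0 < Module.finrank ℝ (rrow A b x₀) := by
  obtain ⟨i, hi⟩ : ∃ i, residual A b x₀ i ≠ 0 := by
    by_contra h
    push Not at h
    exact hx₀ (mulA_eq_of_residual_apply h)
  have hrow : row A i ≠ 0 := fun h => hi (residual_apply_of_row_eq_zero hsol x₀ h)
  have hmem : row A i ∈ rrow A b x₀ := by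
    refine Submodule.subset_span ⟨i, rfl, fun h => hi ?_⟩
    rw [residual, PiLp.sub_apply, mulA_apply_eq_inner, h, sub_self]
  refine Nat.pos_of_ne_zero fun h => hrow ?_
  rw [Submodule.finrank_eq_zero] at h
  rw [h] at hmem
  exact (Submodule.mem_bot ℝ).1 hmem

theorem ConvergesAlong.mono {Ω : Type*} [MeasurableSpace Ω] {μ : Measure Ω}
    {A : Matrix (Fin n) (Fin d) ℝ} {b : E n} {x₀ : E d} {x : ℕ → Ω → E d} {w : ℕ → Ω → E n}
    {hw : ∀ k, Measurable (w k)} {γ : ℝ} {κ κ' : ℝ≥0} (hκ : κ ≤ κ')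
    (h : ConvergesAlong μ A b x₀ x w hw γ κ) : ConvergesAlong μ A b x₀ x w hw γ κ' := by
  obtain ⟨τ, h1, h2, h3, h4⟩ := h
  exact ⟨τ, h1, h2, h3, fun l => (h4 l).trans (by gcongr)⟩

theorem IsMethod.exists_convergesAlong_rate {A : Matrix (Fin n) (Fin d) ℝ} {b : E n}
    (hsol : ∃ xs, mulA A xs = b) {φ : E d → PMF (E n)} {c : ℝ≥0} (hφ : IsMethod A b φ c)
    (x₀ : E d) : ∃ κ : ℝ≥0, ∀ {Ω : Type*} [MeasurableSpace Ω] (μ : Measure Ω)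
      [IsProbabilityMeasure μ] (x : ℕ → Ω → E d) (w : ℕ → Ω → E n)
      (hgen : Generates μ A b x₀ (ofStep φ) x w),
      ConvergesAlong μ A b x₀ x w hgen.measurable (rate A φ) κ := by
  obtain ⟨g, hg0, hg1, hg⟩ := hφ.exists_contraction hsol
  have hz := mulA_projSol hsol x₀
  rcases (rate_nonneg A φ).lt_or_eq with hpos | h0
  · obtain ⟨M, hM⟩ := exists_pow_lt_of_lt_one hpos hg1
    -- Using M + 1 instead of M makes the number of contractions per stage visibly positive.
    refine ⟨((M + 1 : ℕ) : ℝ≥0) * c, fun {Ω} _ μ _ x w hgen => ?_⟩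
    refine hgen.convergesAlong hsol hφ.support_subset (hg _ hz) M.succ_pos
      (Filter.Eventually.of_forall fun ω k l hk => ?_)
    exact hgen.norm_sq_sub_le_pow_count hz hg0 hg1.le
      ((pow_le_pow_of_le_one hg0 hg1.le M.le_succ).trans hM.le) ω k l hk
  -- For rate 0 the error must vanish at every stage, and d + 1 contractions achieve this already at
  -- the first.
  · refine ⟨((d + 1 : ℕ) : ℝ≥0) * c, fun {Ω} _ μ _ x w hgen => ?_⟩
    refine hgen.convergesAlong hsol hφ.support_subset (hg _ hz) d.succ_pos ?_
    filter_upwards [hgen.ae_mem_support (Set.countable_range _) hφ.support_subset]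
      with ω hω k l hk
    have : d < (d + 1) * (l + 1) := by nlinarith
    rw [hgen.eq_of_dim_lt_count hz h0.symm hg1 hω (this.trans_le hk), norm_zero, ← h0]
    simp

end AdaptiveKaczmarz

open AdaptiveKaczmarz in
theorem mainTheorem9 {n d : ℕ} (A : Matrix (Fin n) (Fin d) ℝ) (b : E n)
    (hsol : ∃ xs : E d, mulA A xs = b) (x₀ : E d)
    (φ : E d → PMF (E n)) (c : ℝ≥0) (hφ : IsMethod A b φ c) :
    -- the procedure is Markovian, magnitude invariant and exploratory, and its rate is below one
    IsMarkovian 1 (ofStep φ) ∧ MagnitudeInvariant A b φ ∧ Exploratory A b x₀ φ ∧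
    0 ≤ rate A φ ∧ rate A φ < 1 ∧
    -- convergence with this rate, and stopping times of mean at most `ℓ κ` for some constant `κ`
    (∃ κ : ℝ≥0, ∀ {Ω : Type*} [MeasurableSpace Ω] (μ : Measure Ω) [IsProbabilityMeasure μ]
      (x : ℕ → Ω → E d) (w : ℕ → Ω → E n) (hgen : Generates μ A b x₀ (ofStep φ) x w),
      ConvergesAlong μ A b x₀ x w hgen.measurable (rate A φ) κ) ∧
    -- with a suitable rate below one, `κ` is `dim rrow(A)`, or `n dim rrow(A) / ψ`
    (mulA A x₀ ≠ b → ∃ γ : ℝ, 0 ≤ γ ∧ γ < 1 ∧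
      ∀ {Ω : Type*} [MeasurableSpace Ω] (μ : Measure Ω) [IsProbabilityMeasure μ]
      (x : ℕ → Ω → E d) (w : ℕ → Ω → E n) (hgen : Generates μ A b x₀ (ofStep φ) x w),
      ConvergesAlong μ A b x₀ x w hgen.measurable γ
        (c * (Module.finrank ℝ (rrow A b x₀) : ℝ≥0))) := by
  refine ⟨isMarkovian_ofStep φ, hφ.magnitudeInvariant hsol, hφ.exploratory hsol x₀,
    rate_nonneg A φ, rate_lt_one A hφ.support_subset,
    hφ.exists_convergesAlong_rate hsol x₀, fun hx₀ => ?_⟩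
  obtain ⟨g, hg0, hg1, hg⟩ := hφ.exists_contraction hsol
  have hz := mulA_projSol hsol x₀
  refine ⟨g, hg0, hg1, fun {Ω} _ μ _ x w hgen => ?_⟩
  -- One contraction per stage gives the constant `c`; the factor dim rrow(A) ≥ 1 only enlarges it.
  refine ConvergesAlong.mono ?_ (hgen.convergesAlong hsol hφ.support_subset (hg _ hz) one_pos
    (Filter.Eventually.of_forall fun ω k l hk =>
      hgen.norm_sq_sub_le_pow_count hz hg0 hg1.le (pow_one g).le ω k l hk))
  rw [Nat.cast_one, one_mul]
  refine le_mul_of_one_le_right' ?_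
  exact_mod_cast finrank_rrow_pos hsol hx₀
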